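/- Let $\Omega\subset\mathbb R^2$ be a bounded Lipschitz domain (nonempty, open, connected, and locally, near each boundary point and in suitable rectangular coordinates, the region strictly above the graph of a Lipschitz function). Let $A(\Omega)$ be its area and $L(\Omega)$ the length (one-dimensional Hausdorff measure) of $\partial\Omega$, which is finite and positive. For $\beta\in\mathbb R$ let $$\lambda_1(\Omega;\beta)=\inf_{0\neq u\in H^1(\Omega)}\frac{\int_\Omega|\nabla u|^2\,dx+\beta\int_{\partial\Omega}u^2\,ds}{\int_\Omega u^2\,dx}$$ (with boundary values of $u$ in the sense of traces) be the first eigenvalue of the Robin Laplacian $-\Delta u=\lambda u$ in $\Omega$, $\frac{\partial u}{\partial\nu}+\beta u=0$ on $\partial\Omega$; the infimum is finite. Fix $\alpha\neq 0$. Then for every bounded Lipschitz domain $\Omega\subset\mathbb R^2$, $$\lambda_1\big(\Omega;\alpha/L(\Omega)\big)\,A(\Omega)<\alpha .$$ Equality holds in the limit for rectangles that degenerate to a line segment: if $\Omega=(0,a)\times(0,b)$ with $a,b>0$, then $$\lambda_1\big(\Omega;\alpha/L(\Omega)\big)\,A(\Omega)\to\alpha\qquad\text{as } b/a\to 0 .$$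 In particular this holds for the rectangles $\Omega_t=(0,t)\times(0,1/t)$, which are bounded Lipschitz domains of area $1$, as $t\to\infty$. -/

import Mathlib

open Set Filter Topology MeasureTheory
open scoped ENNReal NNReal ContDiff

noncomputable section

/-- The Euclidean plane. -/
abbrev Plane : Type := EuclideanSpace ℝ (Fin 2)

/-- A bounded Lipschitz domain in the plane: a nonempty, connected, bounded open set which, near
each of its boundary points and in suitable rectangular coordinates, is the set of points lying
strictly above the graph of a Lipschitz function. -/
structure IsBoundedLipschitzDomain (Ω : Set Plane) : Prop where
  isOpen : IsOpen Ω
  isConnected : IsConnected Ω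
  isBounded : Bornology.IsBounded Ω
  lipschitz_boundary : ∀ x ∈ frontier Ω,
    ∃ (e : Plane ≃ₗᵢ[ℝ] Plane) (K : ℝ≥0) (b : ℝ → ℝ) (r : ℝ),
      LipschitzWith K b ∧ 0 < r ∧
        ∀ y ∈ Metric.ball x r, y ∈ Ω ↔ b (e y 0) < e y 1

/-- The area `A(Ω)`. -/
def area (Ω : Set Plane) : ℝ := (volume Ω).toReal

/-- Arc length on the boundary of `Ω`: the one-dimensional Hausdorff measure on `∂Ω`. -/
def arcLength (Ω : Set Plane) : Measure Plane :=
  (Measure.hausdorffMeasure 1 : Measure Plane).restrict (frontier Ω)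

/-- The perimeter `L(Ω)`, the length of the boundary (it is `0` if the length is infinite). -/
def perimeter (Ω : Set Plane) : ℝ := (arcLength Ω univ).toReal

/-- `u` belongs to the Sobolev space `H¹(Ω)` and `G` is its weak gradient. -/
structure IsSobolevWithGradient (Ω : Set Plane) (u : Plane → ℝ) (G : Plane → Plane) : Prop where
  memLp : MemLp u 2 (volume.restrict Ω)
  memLp_gradient : MemLp G 2 (volume.restrict Ω)
  integral_by_parts : ∀ φ : Plane → ℝ, ContDiff ℝ ∞ φ → HasCompactSupport φ → tsupport φ ⊆ Ω →
    ∀ v : Plane,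
      ∫ x in Ω, u x * fderiv ℝ φ x v = - ∫ x in Ω, inner ℝ (G x) v * φ x

/-- `w` is the boundary trace of the function `u ∈ H¹(Ω)` with weak gradient `G`: some sequence of
functions that are smooth up to the boundary tends to `u` in `H¹(Ω)` while its restrictions
to `∂Ω` tend to `w` in `L²(∂Ω)`. -/
structure IsBoundaryTrace (Ω : Set Plane) (u : Plane → ℝ) (G : Plane → Plane) (w : Plane → ℝ) :
    Prop where
  memLp : MemLp w 2 (arcLength Ω)
  approx : ∃ φ : ℕ → Plane → ℝ, (∀ n, ContDiff ℝ ∞ (φ n)) ∧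
    Tendsto (fun n => eLpNorm (fun x => φ n x - u x) 2 (volume.restrict Ω)) atTop (𝓝 0) ∧
    Tendsto (fun n => eLpNorm (fun x => gradient (φ n) x - G x) 2 (volume.restrict Ω))
      atTop (𝓝 0) ∧
    Tendsto (fun n => eLpNorm (fun x => φ n x - w x) 2 (arcLength Ω)) atTop (𝓝 0)

/-- The Robin Rayleigh quotient of a function `u` on `Ω` with gradient `G` and boundary
trace `w`. -/
def robinQuotient (Ω : Set Plane) (α : ℝ) (u : Plane → ℝ) (G : Plane → Plane) (w : Plane → ℝ) :
    ℝ :=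
  ((∫ x in Ω, ‖G x‖ ^ 2) + α * ∫ x, w x ^ 2 ∂(arcLength Ω)) / ∫ x in Ω, u x ^ 2

/-- The values of the Robin Rayleigh quotient with parameter `α` on the nonzero elements
of `H¹(Ω)`. -/
def robinValues (Ω : Set Plane) (α : ℝ) : Set ℝ :=
  {q | ∃ (u : Plane → ℝ) (G : Plane → Plane) (w : Plane → ℝ),
    IsSobolevWithGradient Ω u G ∧ IsBoundaryTrace Ω u G w ∧
      ¬ u =ᵐ[volume.restrict Ω] 0 ∧ q = robinQuotient Ω α u G w}

/-- The first eigenvalue `λ₁(Ω; α)` of the Robin Laplacian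
(`-Δu = λu` in `Ω`, `∂u/∂ν + αu = 0` on `∂Ω`), given by the variational principle as the
infimum of the Rayleigh quotient over nonzero functions in `H¹(Ω)`. -/
def robinEigenvalue₁ (Ω : Set Plane) (α : ℝ) : ℝ := sInf (robinValues Ω α)

/-- The open rectangle `(0, a) × (0, b)`. -/
def openRectangle (a b : ℝ) : Set Plane :=
  {x | (0 < x 0 ∧ x 0 < a) ∧ (0 < x 1 ∧ x 1 < b)}

end

/-! ### One-dimensional estimates -/

/-! With `β = α / L`, constants have Robin quotient `α / A`, so non-strict inequality is immediate.
For strictness, test with `1 + τ α ψ`, where `ψ ≥ 0` is a bump supported in `Ω`: the boundary term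
does not move, the gradient term is of order `τ²`, and the denominator changes at first order by `2
τ α ∫ ψ`, which has the sign of `α`. For small `τ > 0` the quotient therefore drops, whatever that
sign (`robinEigenvalue₁_mul_area_lt`).

This needs an infimum that is not a default value. In a Lipschitz chart, integration along the short
segments above the graph bounds the boundary `L²` norm by the `H¹` norm, with a factor in front of
the gradient as small as desired. Compactness of `∂Ω` makes this global and also gives finite length
(`IsBoundedLipschitzDomain.hasTraceEstimate`). The gradient term then absorbs a negative boundary
term.

For thin rectangles a matching lower bound is needed. Across the short direction, a function is
nearly constant up to its gradient, so the boundary integral is about `2 / b` times the area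
integral. Which one-sided form is needed depends on the sign of `α`: `two_mul_integral_sq_le` for `α
> 0`, `integral_arcLength_sq_le` for `α < 0`. Both come from the same one-dimensional estimates with
a Young parameter `η`. Taking `η = √(b / a)` sends the leading constant to its sharp value while
keeping the gradient coefficient small enough to be absorbed. Traces being limits of smooth
functions, inequalities for smooth functions suffice (`le_of_mem_robinValues`). -/

theorem sq_sub_le_mul_integral_sq {f f' : ℝ → ℝ} (hf : ∀ t, HasDerivAt f (f' t) t)
    (hf' : Continuous f') {s ℓ : ℝ} (hs : 0 ≤ s) (hsℓ : s ≤ ℓ) :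
    (f s - f 0) ^ 2 ≤ ℓ * ∫ t in (0 : ℝ)..ℓ, f' t ^ 2 := by
  have hmono : ∫ t in (0 : ℝ)..s, f' t ^ 2 ≤ ∫ t in (0 : ℝ)..ℓ, f' t ^ 2 :=
    intervalIntegral.integral_mono_interval le_rfl hs hsℓ
      (ae_of_all _ fun t => sq_nonneg (f' t)) ((hf'.pow 2).intervalIntegrable _ _)
  have hnn : 0 ≤ ∫ t in (0 : ℝ)..s, f' t ^ 2 :=
    intervalIntegral.integral_nonneg hs fun t _ => sq_nonneg _
  have key : (f s - f 0) ^ 2 ≤ s * ∫ t in (0 : ℝ)..s, f' t ^ 2 := by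
    rcases hs.eq_or_lt with rfl | hs0
    · simp
    have hftc : ∫ t in (0 : ℝ)..s, f' t = f s - f 0 :=
      intervalIntegral.integral_eq_sub_of_hasDerivAt (fun t _ => hf t)
        (hf'.intervalIntegrable _ _)
    -- Cauchy–Schwarz by hand: `c` is the mean of `f'`, and its variance on `[0, s]` is nonnegative.
    set c := (f s - f 0) / s with hc
    have h0 : 0 ≤ ∫ t in (0 : ℝ)..s, (f' t - c) ^ 2 :=
      intervalIntegral.integral_nonneg hs fun t _ => sq_nonneg _
    have h1 : ∫ t in (0 : ℝ)..s, (f' t - c) ^ 2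
        = (∫ t in (0 : ℝ)..s, f' t ^ 2) - 2 * c * (∫ t in (0 : ℝ)..s, f' t) + c ^ 2 * s := by
      have : ∀ t, (f' t - c) ^ 2 = f' t ^ 2 - 2 * c * f' t + c ^ 2 := fun t => by ring
      simp_rw [this]
      rw [intervalIntegral.integral_add, intervalIntegral.integral_sub,
        intervalIntegral.integral_const_mul, intervalIntegral.integral_const]
      · simp; ring
      all_goals exact Continuous.intervalIntegrable (by fun_prop) _ _
    have h2 : c * s = f s - f 0 := by rw [hc]; field_simp
    rw [h1, hftc, ← h2] at h0
    rw [← h2]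
    nlinarith
  nlinarith

theorem lintegral_Ioo_ofReal_eq {g : ℝ → ℝ} (hg : Continuous g) (h0 : ∀ t, 0 ≤ g t) {ℓ : ℝ}
    (hℓ : 0 ≤ ℓ) :
    ∫⁻ t in Ioo 0 ℓ, ENNReal.ofReal (g t) = ENNReal.ofReal (∫ t in (0 : ℝ)..ℓ, g t) := by
  rw [intervalIntegral.integral_of_le hℓ, integral_Ioc_eq_integral_Ioo,
    ofReal_integral_eq_lintegral_ofReal]
  · exact (hg.integrableOn_Icc).mono_set Ioo_subset_Icc_self
  · exact ae_of_all _ h0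

theorem lintegral_ofReal_add_le_of_integral {g₁ g₂ : ℝ → ℝ} (h₁ : Continuous g₁)
    (h₂ : Continuous g₂) (h₁0 : ∀ t, 0 ≤ g₁ t) (h₂0 : ∀ t, 0 ≤ g₂ t) {x A B ℓ : ℝ} (hℓ : 0 ≤ ℓ)
    (hA : 0 ≤ A) (hB : 0 ≤ B)
    (h : x ≤ A * (∫ t in (0 : ℝ)..ℓ, g₁ t) + B * ∫ t in (0 : ℝ)..ℓ, g₂ t) :
    ENNReal.ofReal x ≤ ENNReal.ofReal A * (∫⁻ t in Ioo 0 ℓ, ENNReal.ofReal (g₁ t))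
      + ENNReal.ofReal B * ∫⁻ t in Ioo 0 ℓ, ENNReal.ofReal (g₂ t) := by
  have i₁ : 0 ≤ ∫ t in (0 : ℝ)..ℓ, g₁ t := intervalIntegral.integral_nonneg hℓ fun t _ => h₁0 t
  have i₂ : 0 ≤ ∫ t in (0 : ℝ)..ℓ, g₂ t := intervalIntegral.integral_nonneg hℓ fun t _ => h₂0 t
  rw [lintegral_Ioo_ofReal_eq h₁ h₁0 hℓ, lintegral_Ioo_ofReal_eq h₂ h₂0 hℓ,
    ← ENNReal.ofReal_mul hA, ← ENNReal.ofReal_mul hB,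
    ← ENNReal.ofReal_add (mul_nonneg hA i₁) (mul_nonneg hB i₂)]
  exact ENNReal.ofReal_le_ofReal h

/-- Young's inequality: the defect is a square divided by `η`. The weight keeps the coefficient of
`y ^ 2` close to `1`, which the sharp rectangle constants require. -/
theorem sq_le_add_mul_sq_sub {x y η : ℝ} (hη : 0 < η) :
    x ^ 2 ≤ (1 + η) * y ^ 2 + (1 + 1 / η) * (x - y) ^ 2 := by
  have h : 0 ≤ (η * y - (x - y)) ^ 2 / η := by positivity
  have e : (η * y - (x - y)) ^ 2 / η
      = (1 + η) * y ^ 2 + (1 + 1 / η) * (x - y) ^ 2 - x ^ 2 := by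
    field_simp; ring
  linarith

/-- A point value is controlled by the mean square of the function and of its derivative. -/
theorem ofReal_mul_sq_le_lintegral {f f' : ℝ → ℝ} (hf : ∀ t, HasDerivAt f (f' t) t)
    (hf' : Continuous f') {ℓ η : ℝ} (hℓ : 0 < ℓ) (hη : 0 < η) :
    ENNReal.ofReal (ℓ * f 0 ^ 2) ≤
      ENNReal.ofReal (1 + η) * (∫⁻ t in Ioo 0 ℓ, ENNReal.ofReal (f t ^ 2))
        + ENNReal.ofReal ((1 + 1 / η) * ℓ ^ 2) * ∫⁻ t in Ioo 0 ℓ, ENNReal.ofReal (f' t ^ 2) := by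
  have hfc : Continuous f := continuous_iff_continuousAt.2 fun t => (hf t).continuousAt
  refine lintegral_ofReal_add_le_of_integral (g₁ := fun t => f t ^ 2) (g₂ := fun t => f' t ^ 2)
    (by fun_prop) (by fun_prop) (fun t => sq_nonneg _) (fun t => sq_nonneg _) hℓ.le
    (by positivity) (by positivity) ?_
  set D := ∫ t in (0 : ℝ)..ℓ, f' t ^ 2
  have h : ∫ t in (0 : ℝ)..ℓ, f 0 ^ 2 ≤
      ∫ t in (0 : ℝ)..ℓ, ((1 + η) * f t ^ 2 + (1 + 1 / η) * (ℓ * D)) := by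
    refine intervalIntegral.integral_mono_on hℓ.le (by simp)
      (Continuous.intervalIntegrable (by fun_prop) _ _) fun t ht => ?_
    have h1 := sq_sub_le_mul_integral_sq hf hf' ht.1 ht.2
    have h2 := sq_le_add_mul_sq_sub (x := f 0) (y := f t) hη
    have h3 : (1 + 1 / η) * (f 0 - f t) ^ 2 ≤ (1 + 1 / η) * (ℓ * D) :=
      mul_le_mul_of_nonneg_left (by nlinarith) (by positivity)
    linarith
  rw [intervalIntegral.integral_add (Continuous.intervalIntegrable (by fun_prop) _ _)
    (by simp), intervalIntegral.integral_const_mul, intervalIntegral.integral_const,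
    intervalIntegral.integral_const] at h
  simp only [sub_zero, smul_eq_mul] at h
  calc ℓ * f 0 ^ 2 ≤ _ := h
    _ = _ := by ring

/-- The mean square of a function is controlled by a point value and the derivative. -/
theorem lintegral_sq_le_ofReal_mul_sq {f f' : ℝ → ℝ} (hf : ∀ t, HasDerivAt f (f' t) t)
    (hf' : Continuous f') {ℓ η : ℝ} (hℓ : 0 < ℓ) (hη : 0 < η) :
    ∫⁻ t in Ioo 0 ℓ, ENNReal.ofReal (f t ^ 2) ≤
      ENNReal.ofReal ((1 + η) * ℓ) * ENNReal.ofReal (f 0 ^ 2)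
        + ENNReal.ofReal ((1 + 1 / η) * ℓ ^ 2) * ∫⁻ t in Ioo 0 ℓ, ENNReal.ofReal (f' t ^ 2) := by
  have hfc : Continuous f := continuous_iff_continuousAt.2 fun t => (hf t).continuousAt
  rw [lintegral_Ioo_ofReal_eq (g := fun t => f t ^ 2) (by fun_prop) (fun t => sq_nonneg _) hℓ.le,
    lintegral_Ioo_ofReal_eq (g := fun t => f' t ^ 2) (by fun_prop) (fun t => sq_nonneg _) hℓ.le]
  set D := ∫ t in (0 : ℝ)..ℓ, f' t ^ 2
  have hD : 0 ≤ D := intervalIntegral.integral_nonneg hℓ.le fun t _ => sq_nonneg _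
  rw [← ENNReal.ofReal_mul (by positivity), ← ENNReal.ofReal_mul (by positivity),
    ← ENNReal.ofReal_add (by positivity) (by positivity)]
  refine ENNReal.ofReal_le_ofReal ?_
  have h : ∫ t in (0 : ℝ)..ℓ, f t ^ 2 ≤
      ∫ t in (0 : ℝ)..ℓ, ((1 + η) * f 0 ^ 2 + (1 + 1 / η) * (ℓ * D)) := by
    refine intervalIntegral.integral_mono_on hℓ.le
      (Continuous.intervalIntegrable (by fun_prop) _ _) (by simp) fun t ht => ?_
    have h1 := sq_sub_le_mul_integral_sq hf hf' ht.1 ht.2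
    have h2 := sq_le_add_mul_sq_sub (x := f t) (y := f 0) hη
    have h3 : (1 + 1 / η) * (f t - f 0) ^ 2 ≤ (1 + 1 / η) * (ℓ * D) :=
      mul_le_mul_of_nonneg_left h1 (by positivity)
    linarith
  rw [intervalIntegral.integral_const] at h
  simp only [sub_zero, smul_eq_mul] at h
  calc _ ≤ _ := h
    _ = _ := by ring

/-! ### The chart map above a graph -/

/-- The point at height `t` above the graph of `b`, in the rectangular coordinates `e`. -/
noncomputable def graphPoint (e : Plane ≃ₗᵢ[ℝ] Plane) (b : ℝ → ℝ) (s t : ℝ) : Plane :=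
  e.symm !₂[s, b s + t]

@[simp] theorem graphPoint_apply_zero (e : Plane ≃ₗᵢ[ℝ] Plane) (b : ℝ → ℝ) (s t : ℝ) :
    e (graphPoint e b s t) 0 = s := by simp [graphPoint]

@[simp] theorem graphPoint_apply_one (e : Plane ≃ₗᵢ[ℝ] Plane) (b : ℝ → ℝ) (s t : ℝ) :
    e (graphPoint e b s t) 1 = b s + t := by simp [graphPoint]

theorem graphPoint_eq_add_smul (e : Plane ≃ₗᵢ[ℝ] Plane) (b : ℝ → ℝ) (s t : ℝ) :
    graphPoint e b s t = graphPoint e b s 0 + t • e.symm (EuclideanSpace.single 1 1) := by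
  apply e.injective
  ext i
  fin_cases i <;> simp [graphPoint]

/-- A shear followed by an isometry preserves area. No regularity of `b` beyond measurability
enters, since only the vertical fibres are translated. -/
theorem measurePreserving_graphPoint (e : Plane ≃ₗᵢ[ℝ] Plane) {b : ℝ → ℝ} (hb : Measurable b) :
    MeasurePreserving (fun p : ℝ × ℝ => graphPoint e b p.1 p.2)
      (volume.prod volume) volume := by
  have h1 : MeasurePreserving (fun p : ℝ × ℝ => (p.1, b p.1 + p.2))
      ((volume : Measure ℝ).prod volume) (volume.prod volume) :=
    (MeasurePreserving.id volume).skew_product (g := fun s t => b s + t) (by fun_prop)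
      (ae_of_all _ fun s => (measurePreserving_add_left volume (b s)).map_eq)
  have h2 := (volume_preserving_finTwoArrow ℝ).symm
  have h3 := PiLp.volume_preserving_toLp (Fin 2)
  exact (e.symm.measurePreserving.comp (h3.comp (h2.comp h1)))

/-- A two-dimensional region swept out above a graph. -/
theorem lintegral_graphPoint_le (e : Plane ≃ₗᵢ[ℝ] Plane) {b : ℝ → ℝ} (hb : Measurable b)
    {J : Set ℝ} {ℓ : ℝ} {Ω : Set Plane} (hΩ : MeasurableSet Ω)
    (hsub : ∀ s ∈ J, ∀ t ∈ Ioo 0 ℓ, graphPoint e b s t ∈ Ω) {g : Plane → ℝ≥0∞}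
    (hg : Measurable g) :
    ∫⁻ s in J, ∫⁻ t in Ioo 0 ℓ, g (graphPoint e b s t) ≤ ∫⁻ x in Ω, g x := by
  have hΨ := measurePreserving_graphPoint e hb
  rw [← hΨ.setLIntegral_comp_preimage hΩ hg,
    ← lintegral_prod (fun p : ℝ × ℝ => g (graphPoint e b p.1 p.2))
      (hg.comp hΨ.measurable).aemeasurable, Measure.prod_restrict]
  exact lintegral_mono_set fun p hp => hsub p.1 hp.1 p.2 hp.2

theorem lintegral_graphPoint_eq (e : Plane ≃ₗᵢ[ℝ] Plane) {b : ℝ → ℝ} (hb : Measurable b)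
    {J : Set ℝ} {ℓ : ℝ} {Ω : Set Plane} (hΩ : MeasurableSet Ω)
    (hiff : ∀ s t, graphPoint e b s t ∈ Ω ↔ s ∈ J ∧ t ∈ Ioo 0 ℓ) {g : Plane → ℝ≥0∞}
    (hg : Measurable g) :
    ∫⁻ s in J, ∫⁻ t in Ioo 0 ℓ, g (graphPoint e b s t) = ∫⁻ x in Ω, g x := by
  have hΨ := measurePreserving_graphPoint e hb
  rw [← hΨ.setLIntegral_comp_preimage hΩ hg,
    ← lintegral_prod (fun p : ℝ × ℝ => g (graphPoint e b p.1 p.2))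
      (hg.comp hΨ.measurable).aemeasurable, Measure.prod_restrict]
  congr 2
  ext p
  exact (hiff p.1 p.2).symm

theorem continuous_gradient {φ : Plane → ℝ} (hφ : ContDiff ℝ ∞ φ) : Continuous (gradient φ) :=
  (InnerProductSpace.toDual ℝ Plane).symm.continuous.comp (hφ.continuous_fderiv (by simp))

theorem hasDerivAt_graphPoint (e : Plane ≃ₗᵢ[ℝ] Plane) (b : ℝ → ℝ) (s : ℝ) {φ : Plane → ℝ}
    (hφ : ContDiff ℝ ∞ φ) (t : ℝ) :
    HasDerivAt (fun t => φ (graphPoint e b s t))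
      (inner ℝ (gradient φ (graphPoint e b s t)) (e.symm (EuclideanSpace.single 1 1))) t := by
  have h1 : HasDerivAt (fun t => graphPoint e b s t) (e.symm (EuclideanSpace.single 1 1)) t := by
    rw [funext (graphPoint_eq_add_smul e b s)]
    simpa using ((hasDerivAt_id t).smul_const
      (e.symm (EuclideanSpace.single (1 : Fin 2) (1 : ℝ)))).const_add (graphPoint e b s 0)
  rw [inner_gradient_left]
  exact ((hφ.differentiable (by simp) _).hasFDerivAt).comp_hasDerivAt t h1

theorem continuous_graphPoint (e : Plane ≃ₗᵢ[ℝ] Plane) (b : ℝ → ℝ) (s : ℝ) :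
    Continuous (fun t => graphPoint e b s t) := by
  rw [funext (graphPoint_eq_add_smul e b s)]
  fun_prop

theorem ofReal_inner_sq_le (e : Plane ≃ₗᵢ[ℝ] Plane) (x : Plane) :
    ENNReal.ofReal (inner ℝ x (e.symm (EuclideanSpace.single 1 1)) ^ 2)
      ≤ ENNReal.ofReal (‖x‖ ^ 2) := by
  refine ENNReal.ofReal_le_ofReal ?_
  have h := abs_real_inner_le_norm x (e.symm (EuclideanSpace.single 1 1))
  rw [e.symm.norm_map, PiLp.norm_single, norm_one, mul_one] at h
  exact sq_le_sq' (by linarith [neg_le_of_abs_le h]) (le_of_abs_le h)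

/-- Trace estimate on a graph with respect to the parameter. -/
theorem lintegral_trace_graph_le (e : Plane ≃ₗᵢ[ℝ] Plane) {b : ℝ → ℝ} (hb : Measurable b)
    {J : Set ℝ} {ℓ η : ℝ} (hℓ : 0 < ℓ) (hη : 0 < η) {Ω : Set Plane}
    (hΩ : MeasurableSet Ω)
    (hsub : ∀ s ∈ J, ∀ t ∈ Ioo 0 ℓ, graphPoint e b s t ∈ Ω) {φ : Plane → ℝ}
    (hφ : ContDiff ℝ ∞ φ) :
    ∫⁻ s in J, ENNReal.ofReal (φ (graphPoint e b s 0) ^ 2) ≤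
      ENNReal.ofReal ((1 + η) / ℓ) * (∫⁻ x in Ω, ENNReal.ofReal (φ x ^ 2))
      + ENNReal.ofReal ((1 + 1 / η) * ℓ) * ∫⁻ x in Ω, ENNReal.ofReal (‖gradient φ x‖ ^ 2) := by
  have hg₁ : Measurable fun x => ENNReal.ofReal (φ x ^ 2) :=
    ((hφ.continuous.pow 2).measurable).ennreal_ofReal
  have hg₂ : Measurable fun x => ENNReal.ofReal (‖gradient φ x‖ ^ 2) :=
    (((continuous_gradient hφ).norm.pow 2).measurable).ennreal_ofReal
  have hΨ := (measurePreserving_graphPoint e hb).measurable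
  have hpt : ∀ s, ENNReal.ofReal (φ (graphPoint e b s 0) ^ 2) ≤
      ENNReal.ofReal ((1 + η) / ℓ)
          * (∫⁻ t in Ioo 0 ℓ, ENNReal.ofReal (φ (graphPoint e b s t) ^ 2))
        + ENNReal.ofReal ((1 + 1 / η) * ℓ)
          * ∫⁻ t in Ioo 0 ℓ, ENNReal.ofReal (‖gradient φ (graphPoint e b s t)‖ ^ 2) := by
    intro s
    have h := ofReal_mul_sq_le_lintegral (hasDerivAt_graphPoint e b s hφ)
      (((continuous_gradient hφ).comp (continuous_graphPoint e b s)).inner continuous_const)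
      hℓ hη
    -- The one-dimensional bound carries a factor `ℓ` on the point value; divide it out.
    have h' := mul_le_mul_right h (ENNReal.ofReal ℓ⁻¹)
    rw [mul_add, ← mul_assoc, ← mul_assoc, ← ENNReal.ofReal_mul (p := ℓ⁻¹) (by positivity),
      ← ENNReal.ofReal_mul (p := ℓ⁻¹) (by positivity),
      ← ENNReal.ofReal_mul (p := ℓ⁻¹) (by positivity)] at h'
    rw [show ℓ⁻¹ * (ℓ * φ (graphPoint e b s 0) ^ 2) = φ (graphPoint e b s 0) ^ 2 by field_simp,
      show ℓ⁻¹ * (1 + η) = (1 + η) / ℓ by field_simp,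
      show ℓ⁻¹ * ((1 + 1 / η) * ℓ ^ 2) = (1 + 1 / η) * ℓ by field_simp] at h'
    refine h'.trans ?_
    gcongr _ + _ * ?_
    exact lintegral_mono fun t => ofReal_inner_sq_le e _
  calc _ ≤ ∫⁻ s in J, _ := lintegral_mono hpt
    _ = ENNReal.ofReal ((1 + η) / ℓ)
          * (∫⁻ s in J, ∫⁻ t in Ioo 0 ℓ, ENNReal.ofReal (φ (graphPoint e b s t) ^ 2))
        + ENNReal.ofReal ((1 + 1 / η) * ℓ)
          * ∫⁻ s in J, ∫⁻ t in Ioo 0 ℓ,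
              ENNReal.ofReal (‖gradient φ (graphPoint e b s t)‖ ^ 2) := by
      have m₁ := (hg₁.comp hΨ).lintegral_prod_right' (ν := volume.restrict (Ioo 0 ℓ))
      simp only [Function.comp_def] at m₁
      have m₂ := (hg₂.comp hΨ).lintegral_prod_right' (ν := volume.restrict (Ioo 0 ℓ))
      rw [lintegral_add_left (m₁.const_mul _), lintegral_const_mul _ m₁,
        lintegral_const_mul]
      exact m₂
    _ ≤ _ := by
      gcongr
      · exact lintegral_graphPoint_le e hb hΩ hsub hg₁
      · exact lintegral_graphPoint_le e hb hΩ hsub hg₂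

/-- On a strip above a graph, the mean square is controlled by the trace on the graph. -/
theorem lintegral_sq_le_trace_graph (e : Plane ≃ₗᵢ[ℝ] Plane) {b : ℝ → ℝ} (hb : Measurable b)
    {J : Set ℝ} {ℓ η : ℝ} (hℓ : 0 < ℓ) (hη : 0 < η) {Ω : Set Plane}
    (hΩ : MeasurableSet Ω)
    (hiff : ∀ s t, graphPoint e b s t ∈ Ω ↔ s ∈ J ∧ t ∈ Ioo 0 ℓ) {φ : Plane → ℝ}
    (hφ : ContDiff ℝ ∞ φ) :
    ∫⁻ x in Ω, ENNReal.ofReal (φ x ^ 2) ≤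
      ENNReal.ofReal ((1 + η) * ℓ) * (∫⁻ s in J, ENNReal.ofReal (φ (graphPoint e b s 0) ^ 2))
      + ENNReal.ofReal ((1 + 1 / η) * ℓ ^ 2)
        * ∫⁻ x in Ω, ENNReal.ofReal (‖gradient φ x‖ ^ 2) := by
  have hg₁ : Measurable fun x => ENNReal.ofReal (φ x ^ 2) :=
    ((hφ.continuous.pow 2).measurable).ennreal_ofReal
  have hg₂ : Measurable fun x => ENNReal.ofReal (‖gradient φ x‖ ^ 2) :=
    (((continuous_gradient hφ).norm.pow 2).measurable).ennreal_ofReal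
  have hΨ := (measurePreserving_graphPoint e hb).measurable
  rw [← lintegral_graphPoint_eq e hb hΩ hiff hg₁, ← lintegral_graphPoint_eq e hb hΩ hiff hg₂]
  have m₁ : Measurable fun s => ENNReal.ofReal (φ (graphPoint e b s 0) ^ 2) :=
    (hg₁.comp hΨ).comp (measurable_id.prodMk measurable_const)
  have m₂ := (hg₂.comp hΨ).lintegral_prod_right' (ν := volume.restrict (Ioo 0 ℓ))
  calc _ ≤ ∫⁻ s in J, (ENNReal.ofReal ((1 + η) * ℓ) * ENNReal.ofReal (φ (graphPoint e b s 0) ^ 2)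
        + ENNReal.ofReal ((1 + 1 / η) * ℓ ^ 2)
          * ∫⁻ t in Ioo 0 ℓ, ENNReal.ofReal (‖gradient φ (graphPoint e b s t)‖ ^ 2)) := by
        refine lintegral_mono fun s => ?_
        refine (lintegral_sq_le_ofReal_mul_sq (hasDerivAt_graphPoint e b s hφ)
          (((continuous_gradient hφ).comp (continuous_graphPoint e b s)).inner continuous_const)
          hℓ hη).trans ?_
        gcongr _ + _ * ?_
        exact lintegral_mono fun t => ofReal_inner_sq_le e _
    _ = _ := by
      rw [lintegral_add_left (m₁.const_mul _), lintegral_const_mul _ m₁]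
      congr 1
      exact lintegral_const_mul _ m₂
/-! ### Smooth functions and limits in `L²` -/

/-- The integral is the squared norm in `Lp`, and the norm is continuous. -/
theorem tendsto_integral_norm_sq {X E : Type*} [MeasurableSpace X] {μ : Measure X}
    [NormedAddCommGroup E] {f : ℕ → X → E} {g : X → E} (hf : ∀ n, MemLp (f n) 2 μ)
    (hg : MemLp g 2 μ)
    (h : Tendsto (fun n => eLpNorm (fun x => f n x - g x) 2 μ) atTop (𝓝 0)) :
    Tendsto (fun n => ∫ x, ‖f n x‖ ^ 2 ∂μ) atTop (𝓝 (∫ x, ‖g x‖ ^ 2 ∂μ)) := by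
  have key : ∀ {u : X → E} (hu : MemLp u 2 μ), ∫ x, ‖u x‖ ^ 2 ∂μ = ‖hu.toLp u‖ ^ 2 := by
    intro u hu
    have h0 : 0 ≤ ∫ x, ‖u x‖ ^ 2 ∂μ := integral_nonneg fun x => by positivity
    rw [Lp.norm_toLp, hu.eLpNorm_eq_integral_rpow_norm (by simp) (by simp),
      ENNReal.toReal_ofReal (by positivity)]
    simp only [ENNReal.toReal_ofNat, Real.rpow_ofNat]
    rw [← Real.rpow_natCast, ← Real.rpow_mul h0]
    norm_num
  simp_rw [fun n => key (hf n), key hg]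
  have := (Lp.tendsto_Lp_iff_tendsto_eLpNorm'' f hf g hg).2 h
  exact this.norm.pow 2

theorem memLp_two_of_continuous {E : Type*} [NormedAddCommGroup E] {μ : Measure Plane}
    [IsFiniteMeasure μ] [SecondCountableTopologyEither Plane E] {S : Set Plane}
    (hS : Bornology.IsBounded S) (hμ : ∀ᵐ x ∂μ, x ∈ S) {f : Plane → E} (hf : Continuous f) :
    MemLp f 2 μ := by
  obtain ⟨C, hC⟩ := hS.isCompact_closure.exists_bound_of_continuousOn hf.continuousOn
  exact MemLp.of_bound hf.aestronglyMeasurable C (hμ.mono fun x hx => hC x (subset_closure hx))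

theorem isFiniteMeasure_volume_restrict {Ω : Set Plane} (hb : Bornology.IsBounded Ω) :
    IsFiniteMeasure (volume.restrict Ω) :=
  ⟨by simpa using hb.measure_lt_top⟩

theorem Bornology.IsBounded.frontier {Ω : Set Plane} (hb : Bornology.IsBounded Ω) :
    Bornology.IsBounded (frontier Ω) :=
  hb.closure.subset frontier_subset_closure

theorem memLp_two_volume_restrict {E : Type*} [NormedAddCommGroup E]
    [SecondCountableTopologyEither Plane E] {Ω : Set Plane} (ho : IsOpen Ω)
    (hb : Bornology.IsBounded Ω) {f : Plane → E} (hf : Continuous f) :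
    MemLp f 2 (volume.restrict Ω) :=
  have := isFiniteMeasure_volume_restrict hb
  memLp_two_of_continuous hb (ae_restrict_mem ho.measurableSet) hf

theorem memLp_two_arcLength {Ω : Set Plane} (hb : Bornology.IsBounded Ω)
    [IsFiniteMeasure (arcLength Ω)] {f : Plane → ℝ} (hf : Continuous f) :
    MemLp f 2 (arcLength Ω) :=
  memLp_two_of_continuous (μ := arcLength Ω) hb.frontier (ae_restrict_mem isClosed_frontier.measurableSet) hf

/-- An inequality for smooth functions bounds the Robin quotients from below. -/
theorem le_of_mem_robinValues {Ω : Set Plane} (ho : IsOpen Ω) (hb : Bornology.IsBounded Ω)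
    [IsFiniteMeasure (arcLength Ω)] {c β : ℝ}
    (h : ∀ φ : Plane → ℝ, ContDiff ℝ ∞ φ → c * ∫ x in Ω, φ x ^ 2 ≤
      (∫ x in Ω, ‖gradient φ x‖ ^ 2) + β * ∫ x, φ x ^ 2 ∂(arcLength Ω)) :
    ∀ q ∈ robinValues Ω β, c ≤ q := by
  rintro q ⟨u, G, w, hu, ⟨hw, φ, hφ, h1, h2, h3⟩, hne, rfl⟩
  -- All three integrals of the quotient are limits along the one approximating sequence `φ`.
  have t1 := tendsto_integral_norm_sq
    (fun n => memLp_two_volume_restrict ho hb (hφ n).continuous) hu.memLp h1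
  have t2 := tendsto_integral_norm_sq
    (fun n => memLp_two_volume_restrict ho hb (continuous_gradient (hφ n))) hu.memLp_gradient h2
  have t3 := tendsto_integral_norm_sq
    (fun n => memLp_two_arcLength hb (hφ n).continuous) hw h3
  simp only [Real.norm_eq_abs, sq_abs] at t1 t3
  have hlim := le_of_tendsto_of_tendsto' (t1.const_mul c) (t2.add (t3.const_mul β))
    fun n => h (φ n) (hφ n)
  have hpos : 0 < ∫ x in Ω, u x ^ 2 := by
    refine lt_of_le_of_ne (integral_nonneg fun x => sq_nonneg _) fun h0 => hne ?_
    have := (integral_eq_zero_iff_of_nonneg (fun x => sq_nonneg (u x))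
      hu.memLp.integrable_sq).1 h0.symm
    filter_upwards [this] with x hx
    simpa using hx
  rw [robinQuotient, le_div_iff₀ hpos]
  exact hlim

/-! ### Smooth test functions and the strict upper bound -/

theorem isSobolevWithGradient_of_contDiff {Ω : Set Plane} (ho : IsOpen Ω)
    (hb : Bornology.IsBounded Ω) {u : Plane → ℝ} (hu : ContDiff ℝ ∞ u) :
    IsSobolevWithGradient Ω u (gradient u) where
  memLp := memLp_two_volume_restrict ho hb hu.continuous
  memLp_gradient := memLp_two_volume_restrict ho hb (continuous_gradient hu)
  integral_by_parts := by
    intro φ hφ hφc hφs v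
    have hu' : Continuous fun x => fderiv ℝ u x v :=
      (hu.continuous_fderiv (by simp)).clm_apply continuous_const
    have hφ' : Continuous fun x => fderiv ℝ φ x v :=
      (hφ.continuous_fderiv (by simp)).clm_apply continuous_const
    have hφ'c : HasCompactSupport fun x => fderiv ℝ φ x v := hφc.fderiv_apply ℝ v
    simp_rw [inner_gradient_left]
    -- Both integrands vanish off `Ω`, so one integrates by parts over the whole plane, with no
    -- boundary term.
    rw [setIntegral_eq_integral_of_forall_compl_eq_zero,
      setIntegral_eq_integral_of_forall_compl_eq_zero,
      integral_mul_fderiv_eq_neg_fderiv_mul_of_integrable]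
    · exact (hu'.mul hφ.continuous).integrable_of_hasCompactSupport hφc.mul_left
    · exact (hu.continuous.mul hφ').integrable_of_hasCompactSupport hφ'c.mul_left
    · exact (hu.continuous.mul hφ.continuous).integrable_of_hasCompactSupport hφc.mul_left
    · exact fun x _ => hu.differentiable (by simp) x
    · exact fun x _ => hφ.differentiable (by simp) x
    · intro x hx
      rw [image_eq_zero_of_notMem_tsupport fun h => hx (hφs h), mul_zero]
    · intro x hx
      rw [fderiv_of_notMem_tsupport (𝕜 := ℝ) fun h => hx (hφs h)]
      simp

theorem robinQuotient_mem_robinValues {Ω : Set Plane} (ho : IsOpen Ω)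
    (hb : Bornology.IsBounded Ω) [IsFiniteMeasure (arcLength Ω)] {u : Plane → ℝ}
    (hu : ContDiff ℝ ∞ u) (hne : ¬ u =ᵐ[volume.restrict Ω] 0) (β : ℝ) :
    robinQuotient Ω β u (gradient u) u ∈ robinValues Ω β := by
  refine ⟨u, gradient u, u, isSobolevWithGradient_of_contDiff ho hb hu,
    ⟨memLp_two_arcLength hb hu.continuous, fun _ => u, fun _ => hu, ?_, ?_, ?_⟩, hne, rfl⟩
  all_goals simp

theorem exists_smooth_bump {Ω : Set Plane} (ho : IsOpen Ω) (hne : Ω.Nonempty) :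
    ∃ ψ : Plane → ℝ, ContDiff ℝ ∞ ψ ∧ HasCompactSupport ψ ∧ (∀ x, ψ x ∈ Icc 0 1) ∧
      (∀ x ∉ Ω, ψ x = 0) ∧ 0 < ∫ x in Ω, ψ x := by
  obtain ⟨p, hp⟩ := hne
  obtain ⟨ψ, h1, h2, h3, h4, h5⟩ :=
    exists_contDiff_tsupport_subset (n := ⊤) (ho.mem_nhds hp)
  have h6 : ∀ x ∉ Ω, ψ x = 0 := fun x hx => image_eq_zero_of_notMem_tsupport fun h => hx (h1 h)
  refine ⟨ψ, h3, h2, fun x => h4 (mem_range_self x), h6, ?_⟩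
  rw [setIntegral_eq_integral_of_forall_compl_eq_zero h6]
  exact h3.continuous.integral_pos_of_hasCompactSupport_nonneg_nonzero h2
    (fun x => (h4 (mem_range_self x)).1) (x := p) (by simp [h5])

theorem gradient_one_add_mul {ψ : Plane → ℝ} (hψ : ContDiff ℝ ∞ ψ) (t : ℝ) (x : Plane) :
    gradient (fun x => 1 + t * ψ x) x = t • gradient ψ x := by
  have h := hψ.differentiable (by simp) x
  rw [gradient, gradient, fderiv_const_add, fderiv_const_mul h, map_smul]

/-- The first eigenvalue is strictly below the Robin quotient of constant functions. -/
theorem robinEigenvalue₁_mul_area_lt {Ω : Set Plane} (ho : IsOpen Ω) (hne : Ω.Nonempty)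
    (hb : Bornology.IsBounded Ω) [IsFiniteMeasure (arcLength Ω)] (hL : 0 < perimeter Ω) {α : ℝ}
    (hα : α ≠ 0) (hbdd : BddBelow (robinValues Ω (α / perimeter Ω))) :
    robinEigenvalue₁ Ω (α / perimeter Ω) * area Ω < α := by
  obtain ⟨ψ, hψ, hψc, hψ01, hψ0, hm⟩ := exists_smooth_bump ho hne
  have := isFiniteMeasure_volume_restrict hb
  have hvol : volume Ω ≠ 0 := (ho.measure_pos volume hne).ne'
  have hA : 0 < area Ω := ENNReal.toReal_pos hvol hb.measure_lt_top.ne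
  set A := area Ω with hAdef
  set D := ∫ x in Ω, ‖gradient ψ x‖ ^ 2 with hD
  set m := ∫ x in Ω, ψ x with hmdef
  set q := ∫ x in Ω, ψ x ^ 2 with hq
  -- The first condition is the desired strict inequality divided by `τ * α ^ 2`; the second keeps
  -- `u` positive, hence nonzero.
  have ev : ∀ᶠ τ in 𝓝[>] (0 : ℝ), τ * (A * D - α * q) < 2 * m ∧ |τ * α| < 1 := by
    have c1 : Tendsto (fun τ : ℝ => τ * (A * D - α * q)) (𝓝 0) (𝓝 (0 * (A * D - α * q))) :=
      Continuous.tendsto (by fun_prop) 0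
    have c2 : Tendsto (fun τ : ℝ => |τ * α|) (𝓝 0) (𝓝 |0 * α|) :=
      Continuous.tendsto (by fun_prop) 0
    exact nhdsWithin_le_nhds ((c1.eventually_lt_const (by linarith)).and
      (c2.eventually_lt_const (by simp)))
  obtain ⟨τ, ⟨hτ1, hτ2⟩, hτ0⟩ := (ev.and self_mem_nhdsWithin).exists
  have hτ0 : 0 < τ := hτ0
  -- The factor `α` makes the first-order change of the quotient negative for either sign of `α`.
  set t := τ * α with ht
  set u : Plane → ℝ := fun x => 1 + t * ψ x with hu
  have hus : ContDiff ℝ ∞ u := contDiff_const.add (contDiff_const.mul hψ)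
  have hupos : ∀ x, 0 < u x := by
    intro x
    have := hψ01 x
    have h1 : |t * ψ x| < 1 := by
      rw [abs_mul, abs_of_nonneg this.1]
      nlinarith [this.1, this.2, abs_nonneg t]
    have := neg_lt_of_abs_lt h1
    simp only [hu]
    linarith
  have hune : ¬ u =ᵐ[volume.restrict Ω] 0 := by
    intro h0
    have : ∀ᵐ x ∂(volume.restrict Ω), False := h0.mono fun x hx => (hupos x).ne' hx
    rw [ae_iff] at this
    simp [hvol] at this
  have hq1 : ∫ x in Ω, ‖gradient u x‖ ^ 2 = t ^ 2 * D := by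
    rw [hD, ← integral_const_mul]
    congr 1 with x
    rw [hu, gradient_one_add_mul hψ, norm_smul, mul_pow, Real.norm_eq_abs, sq_abs]
  have hq2 : ∫ x, u x ^ 2 ∂(arcLength Ω) = perimeter Ω := by
    have : ∫ x, u x ^ 2 ∂(arcLength Ω) = ∫ x, (1 : ℝ) ∂(arcLength Ω) := by
      refine setIntegral_congr_fun isClosed_frontier.measurableSet fun x hx => ?_
      simp [hu, hψ0 x fun h => (ho.inter_frontier_eq ▸ ⟨h, hx⟩ : x ∈ (∅ : Set Plane))]
    rw [this]
    simp [perimeter, Measure.real]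
  have hint : Integrable ψ (volume.restrict Ω) :=
    (hψ.continuous.integrable_of_hasCompactSupport hψc).restrict
  have hint2 : Integrable (fun x => ψ x ^ 2) (volume.restrict Ω) :=
    (memLp_two_volume_restrict ho hb hψ.continuous).integrable_sq
  have hq3 : ∫ x in Ω, u x ^ 2 = A + 2 * t * m + t ^ 2 * q := by
    have : ∀ x, u x ^ 2 = 1 + 2 * t * ψ x + t ^ 2 * ψ x ^ 2 := fun x => by
      simp only [hu]; ring
    simp_rw [this]
    have hint1 : Integrable (fun x => 1 + 2 * t * ψ x) (volume.restrict Ω) :=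
      (integrable_const _).add (hint.const_mul _)
    rw [integral_add hint1 (hint2.const_mul _),
      integral_add (integrable_const _) (hint.const_mul _), integral_const_mul,
      integral_const_mul]
    simp [hAdef, area, Measure.real, hmdef, hq]
  have hU : 0 < ∫ x in Ω, u x ^ 2 := by
    refine lt_of_le_of_ne (integral_nonneg fun x => sq_nonneg _) fun h0 => hune ?_
    have := (integral_eq_zero_iff_of_nonneg (fun x => sq_nonneg (u x))
      (memLp_two_volume_restrict ho hb hus.continuous).integrable_sq).1 h0.symm
    filter_upwards [this] with x hx
    simpa using hx
  have hle := csInf_le hbdd (robinQuotient_mem_robinValues ho hb hus hune (α / perimeter Ω))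
  rw [robinQuotient, hq1, hq2, div_mul_cancel₀ _ hL.ne'] at hle
  refine lt_of_le_of_lt (mul_le_mul_of_nonneg_right hle hA.le) ?_
  rw [div_mul_eq_mul_div, div_lt_iff₀ hU, hq3, ht]
  have := mul_lt_mul_of_pos_right hτ1 (show 0 < τ * α ^ 2 by positivity)
  nlinarith
/-! ### Length and trace estimates on Lipschitz boundaries -/

/-- Projection to the first axis does not increase one-dimensional Hausdorff measure. The image of
the boundary contains a nonempty open set: each vertical line meeting `Ω` must leave it, since `Ω`
is bounded, and so crosses the boundary. -/
theorem perimeter_pos {Ω : Set Plane} (ho : IsOpen Ω) (hne : Ω.Nonempty)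
    (hb : Bornology.IsBounded Ω) [IsFiniteMeasure (arcLength Ω)] : 0 < perimeter Ω := by
  obtain ⟨p, hp⟩ := hne
  have hline : ∀ s : ℝ, (!₂[s, p 1] : Plane) ∈ Ω → s ∈ (fun y : Plane => y 0) '' frontier Ω := by
    intro s hs
    have hc : Continuous fun t : ℝ => (!₂[s, t] : Plane) := by fun_prop
    have hfr : (frontier ((fun t : ℝ => (!₂[s, t] : Plane)) ⁻¹' Ω)).Nonempty := by
      refine nonempty_frontier_iff.2 ⟨⟨p 1, hs⟩, fun huniv => ?_⟩
      obtain ⟨C, hC⟩ := hb.exists_norm_le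
      have hmem : (!₂[s, |C| + 1] : Plane) ∈ Ω :=
        (huniv ▸ mem_univ (|C| + 1) : |C| + 1 ∈ (fun t : ℝ => (!₂[s, t] : Plane)) ⁻¹' Ω)
      have h1 := (PiLp.norm_apply_le (!₂[s, |C| + 1] : Plane) 1).trans (hC _ hmem)
      simp only [Matrix.cons_val_one, Matrix.cons_val_zero,
        Real.norm_eq_abs] at h1
      linarith [le_abs_self C, le_abs_self (|C| + 1)]
    obtain ⟨t, ht⟩ := hfr
    exact ⟨_, hc.frontier_preimage_subset Ω ht, by simp⟩
  have hopen : IsOpen {s : ℝ | (!₂[s, p 1] : Plane) ∈ Ω} :=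
    ho.preimage (f := fun s : ℝ => (!₂[s, p 1] : Plane)) (by fun_prop)
  have hpos : 0 < volume {s : ℝ | (!₂[s, p 1] : Plane) ∈ Ω} := by
    refine hopen.measure_pos _ ⟨p 0, ?_⟩
    have : (!₂[p 0, p 1] : Plane) = p := by ext i; fin_cases i <;> rfl
    simpa [this] using hp
  have hlip : LipschitzWith 1 (fun y : Plane => y 0) :=
    LipschitzWith.of_dist_le_mul fun x y => by
      simpa [dist_eq_norm] using PiLp.norm_apply_le (x - y) 0
  have h2 := hlip.hausdorffMeasure_image_le (d := 1) zero_le_one (frontier Ω)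
  rw [hausdorffMeasure_real] at h2
  simp only [ENNReal.coe_one, ENNReal.one_rpow, one_mul] at h2
  refine ENNReal.toReal_pos ?_ (measure_ne_top _ _)
  rw [arcLength, Measure.restrict_apply_univ]
  exact (hpos.trans_le ((measure_mono hline).trans h2)).ne'

theorem lipschitzWith_graphPoint (e : Plane ≃ₗᵢ[ℝ] Plane) {b : ℝ → ℝ} {K : ℝ≥0}
    (hb : LipschitzWith K b) : LipschitzWith (1 + K) (fun s => graphPoint e b s 0) := by
  refine LipschitzWith.of_dist_le_mul fun s s' => ?_
  have h := hb.dist_le_mul s s'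
  rw [graphPoint, graphPoint, e.symm.dist_map, EuclideanSpace.dist_eq]
  simp only [Fin.sum_univ_two, Matrix.cons_val_zero, Matrix.cons_val_one,
    add_zero, NNReal.coe_add, NNReal.coe_one]
  refine (Real.sqrt_le_left (by positivity)).2 ?_
  nlinarith [dist_nonneg (x := s) (y := s'), dist_nonneg (x := b s) (y := b s'), K.coe_nonneg,
    mul_nonneg K.coe_nonneg (dist_nonneg (x := s) (y := s'))]

/-- Arc length on a piece of a Lipschitz graph is dominated by the parameter measure. -/
theorem lintegral_hausdorffMeasure_graph_le (e : Plane ≃ₗᵢ[ℝ] Plane) {b : ℝ → ℝ} {K : ℝ≥0}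
    (hb : LipschitzWith K b) {F : Set Plane}
    (hgraph : ∀ y ∈ F, e y 1 = b (e y 0)) {g : Plane → ℝ≥0∞} (hg : Measurable g) :
    ∫⁻ x in F, g x ∂(Measure.hausdorffMeasure 1) ≤
      (1 + K : ℝ≥0) * ∫⁻ s in (fun s => graphPoint e b s 0) ⁻¹' F, g (graphPoint e b s 0) := by
  have hlip := lipschitzWith_graphPoint e hb
  set h : ℝ → Plane := fun s => graphPoint e b s 0 with hh
  have hm : Measurable h := hlip.continuous.measurable
  have hinv : ∀ y ∈ F, h (e y 0) = y := by
    intro y hy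
    apply e.injective
    ext i
    fin_cases i
    · simp [hh]
    · simpa [hh] using (hgraph y hy).symm
  have hle : (Measure.hausdorffMeasure 1 : Measure Plane).restrict F ≤
      ((1 + K : ℝ≥0) : ℝ≥0∞) • (volume.restrict (h ⁻¹' F)).map h := by
    -- `F` is covered by the image of its parameters under the `(1 + K)`-Lipschitz map `h`.
    refine Measure.le_iff.2 fun E hE => ?_
    rw [Measure.restrict_apply hE, Measure.smul_apply, Measure.map_apply hm hE,
      Measure.restrict_apply (hm hE), smul_eq_mul, ← preimage_inter]
    have hsub : E ∩ F ⊆ h '' (h ⁻¹' (E ∩ F)) := fun y hy =>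
      ⟨e y 0, by rw [mem_preimage, hinv y hy.2]; exact hy, hinv y hy.2⟩
    refine (measure_mono hsub).trans ?_
    simpa [hausdorffMeasure_real] using
      hlip.hausdorffMeasure_image_le (d := 1) zero_le_one (h ⁻¹' (E ∩ F))
  calc _ ≤ ∫⁻ x, g x ∂(((1 + K : ℝ≥0) : ℝ≥0∞) • (volume.restrict (h ⁻¹' F)).map h) :=
        lintegral_mono' hle le_rfl
    _ = _ := by rw [lintegral_smul_measure, lintegral_map hg hm, smul_eq_mul]

/-- A part of the boundary has finite length, and the `L²` norm of boundary values on it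
is controlled by the `H¹` norm, with an arbitrarily small factor in front of the gradient. -/
def HasTraceEstimate (Ω S : Set Plane) : Prop :=
  (Measure.hausdorffMeasure 1 : Measure Plane) (frontier Ω ∩ S) < ⊤ ∧
  ∀ ε : ℝ, 0 < ε → ∃ C : ℝ, 0 ≤ C ∧ ∀ φ : Plane → ℝ, ContDiff ℝ ∞ φ →
    ∫⁻ x in frontier Ω ∩ S, ENNReal.ofReal (φ x ^ 2) ∂(Measure.hausdorffMeasure 1) ≤
      ENNReal.ofReal ε * (∫⁻ x in Ω, ENNReal.ofReal (‖gradient φ x‖ ^ 2))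
      + ENNReal.ofReal C * ∫⁻ x in Ω, ENNReal.ofReal (φ x ^ 2)

theorem HasTraceEstimate.mono {Ω S T : Set Plane} (hST : S ⊆ T) (h : HasTraceEstimate Ω T) :
    HasTraceEstimate Ω S := by
  refine ⟨(measure_mono (inter_subset_inter_right _ hST)).trans_lt h.1, fun ε hε => ?_⟩
  obtain ⟨C, hC, hφ⟩ := h.2 ε hε
  exact ⟨C, hC, fun φ h => (lintegral_mono_set (inter_subset_inter_right _ hST)).trans (hφ φ h)⟩

theorem HasTraceEstimate.union {Ω S T : Set Plane} (hS : HasTraceEstimate Ω S)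
    (hT : HasTraceEstimate Ω T) : HasTraceEstimate Ω (S ∪ T) := by
  refine ⟨?_, fun ε hε => ?_⟩
  · rw [inter_union_distrib_left]
    exact measure_union_lt_top hS.1 hT.1
  obtain ⟨C, hC, h₁⟩ := hS.2 (ε / 2) (half_pos hε)
  obtain ⟨C', hC', h₂⟩ := hT.2 (ε / 2) (half_pos hε)
  refine ⟨C + C', add_nonneg hC hC', fun φ hφ => ?_⟩
  rw [inter_union_distrib_left]
  refine (lintegral_union_le _ _ _).trans ((add_le_add (h₁ φ hφ) (h₂ φ hφ)).trans (le_of_eq ?_))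
  rw [ENNReal.ofReal_add hC hC', ← add_halves ε,
    ENNReal.ofReal_add (half_pos hε).le (half_pos hε).le]
  simp only [add_halves]
  ring

/-- Half the chart radius leaves room for vertical segments of length at most `r / 2`: starting on
the boundary in the half ball, they stay in the chart, hence in `Ω`, and the graph estimate applies.
-/
theorem IsBoundedLipschitzDomain.exists_hasTraceEstimate {Ω : Set Plane}
    (hΩ : IsBoundedLipschitzDomain Ω) {x : Plane} (hx : x ∈ frontier Ω) :
    ∃ t ∈ 𝓝[frontier Ω] x, HasTraceEstimate Ω t := by
  obtain ⟨e, K, b, r, hb, hr, hchart⟩ := hΩ.lipschitz_boundary x hx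
  have hbm : Measurable b := hb.continuous.measurable
  -- A boundary point is not above the graph, as it is not in the open set `Ω`; strictly below, it
  -- would have a neighbourhood missing `Ω`.
  have hgraph : ∀ y ∈ frontier Ω ∩ Metric.ball x (r / 2), e y 1 = b (e y 0) := by
    rintro y ⟨hy, hyr⟩
    have hyr' : y ∈ Metric.ball x r := Metric.ball_subset_ball (by linarith) hyr
    have hnot : y ∉ Ω := fun h =>
      (hΩ.isOpen.inter_frontier_eq ▸ ⟨h, hy⟩ : y ∈ (∅ : Set Plane))
    refine le_antisymm (not_lt.1 fun h => hnot ((hchart y hyr').2 h)) (not_lt.1 fun h => ?_)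
    have hU : {z | e z 1 < b (e z 0)} ∩ Metric.ball x r ∈ 𝓝 y := by
      refine inter_mem ?_ (Metric.isOpen_ball.mem_nhds hyr')
      exact (isOpen_lt (by fun_prop) (by have := hb.continuous; fun_prop)).mem_nhds h
    obtain ⟨z, ⟨hz1, hz2⟩, hz3⟩ := mem_closure_iff_nhds.1 (frontier_subset_closure hy) _ hU
    exact lt_asymm hz1 ((hchart z hz2).1 hz3)
  have hsub : ∀ ℓ ≤ r / 2,
      ∀ s ∈ (fun s => graphPoint e b s 0) ⁻¹' (frontier Ω ∩ Metric.ball x (r / 2)),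
      ∀ t ∈ Ioo 0 ℓ, graphPoint e b s t ∈ Ω := by
    intro ℓ hℓ s hs t ht
    refine (hchart _ ?_).2 ?_
    · have h1 : dist (graphPoint e b s t) (graphPoint e b s 0) ≤ r / 2 := by
        rw [graphPoint_eq_add_smul, dist_eq_norm, add_sub_cancel_left, norm_smul,
          e.symm.norm_map, PiLp.norm_single, norm_one, mul_one, Real.norm_eq_abs,
          abs_of_pos ht.1]
        linarith [ht.2]
      have h2 := Metric.mem_ball.1 hs.2
      rw [Metric.mem_ball]
      linarith [dist_triangle (graphPoint e b s t) (graphPoint e b s 0) x]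
    · simpa using ht.1
  refine ⟨Metric.ball x (r / 2), mem_nhdsWithin_of_mem_nhds (Metric.ball_mem_nhds x (half_pos hr)),
    ?_, fun ε hε => ?_⟩
  · have h1 := lintegral_hausdorffMeasure_graph_le e hb hgraph (g := 1) measurable_one
    simp only [Pi.one_apply, lintegral_one, Measure.restrict_apply_univ] at h1
    refine h1.trans_lt (ENNReal.mul_lt_top ENNReal.coe_lt_top ?_)
    have hsubset : (fun s => graphPoint e b s 0) ⁻¹' (frontier Ω ∩ Metric.ball x (r / 2)) ⊆
        Metric.ball (e x 0) (r / 2) := by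
      intro s hs
      have h2 := Metric.mem_ball.1 hs.2
      rw [← e.dist_map] at h2
      refine lt_of_le_of_lt ?_ h2
      have := PiLp.norm_apply_le (e (graphPoint e b s 0) - e x) 0
      simpa [dist_eq_norm] using this
    exact (measure_mono hsubset).trans_lt measure_ball_lt_top
  · set κ : ℝ := 1 + K with hκ
    have hκ0 : 0 < κ := by positivity
    -- With `η = 1` the gradient coefficient is `κ * (2 * ℓ)`, so this depth makes it at most `ε`.
    set ℓ := min (r / 2) (ε / (2 * κ)) with hℓ
    have hℓ0 : 0 < ℓ := lt_min (half_pos hr) (by positivity)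
    refine ⟨κ * ((1 + 1) / ℓ), by positivity, fun φ hφ => ?_⟩
    have hg : Measurable fun x => ENNReal.ofReal (φ x ^ 2) :=
      ((hφ.continuous.pow 2).measurable).ennreal_ofReal
    refine (lintegral_hausdorffMeasure_graph_le e hb hgraph hg).trans ?_
    have h1 := lintegral_trace_graph_le e hbm hℓ0 one_pos hΩ.isOpen.measurableSet
      (hsub ℓ (min_le_left _ _)) hφ
    refine (mul_le_mul_right h1 _).trans ?_
    have hκ' : ((1 + K : ℝ≥0) : ℝ≥0∞) = ENNReal.ofReal κ := by
      rw [hκ, ← NNReal.coe_one, ← NNReal.coe_add, ENNReal.ofReal_coe_nnreal]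
    rw [hκ', mul_add, ← mul_assoc, ← mul_assoc, ← ENNReal.ofReal_mul hκ0.le,
      ← ENNReal.ofReal_mul hκ0.le, add_comm]
    gcongr
    have : ℓ ≤ ε / (2 * κ) := min_le_right _ _
    rw [le_div_iff₀ (by positivity)] at this
    linarith

theorem IsBoundedLipschitzDomain.hasTraceEstimate {Ω : Set Plane}
    (hΩ : IsBoundedLipschitzDomain Ω) : HasTraceEstimate Ω (frontier Ω) := by
  have hc : IsCompact (frontier Ω) :=
    Metric.isCompact_of_isClosed_isBounded isClosed_frontier hΩ.isBounded.frontier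
  refine hc.induction_on ?_ (fun s t => HasTraceEstimate.mono) (fun s t => HasTraceEstimate.union)
    fun x hx => hΩ.exists_hasTraceEstimate hx
  refine ⟨by simp, fun ε _ => ⟨0, le_rfl, fun φ _ => by simp⟩⟩

theorem IsBoundedLipschitzDomain.isFiniteMeasure_arcLength {Ω : Set Plane}
    (hΩ : IsBoundedLipschitzDomain Ω) : IsFiniteMeasure (arcLength Ω) :=
  ⟨by simpa [arcLength] using hΩ.hasTraceEstimate.1⟩

theorem lintegral_ofReal_eq_of_memLp_two {X E : Type*} [MeasurableSpace X] {μ : Measure X}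
    [NormedAddCommGroup E] {f : X → E} (hf : MemLp f 2 μ) :
    ∫⁻ x, ENNReal.ofReal (‖f x‖ ^ 2) ∂μ = ENNReal.ofReal (∫ x, ‖f x‖ ^ 2 ∂μ) :=
  (ofReal_integral_eq_lintegral_ofReal hf.norm.integrable_sq
    (ae_of_all _ fun x => by positivity)).symm

theorem lintegral_sq_eq_ofReal {Ω : Set Plane} (ho : IsOpen Ω)
    (hb : Bornology.IsBounded Ω) {φ : Plane → ℝ} (hφ : ContDiff ℝ ∞ φ) :
    ∫⁻ x in Ω, ENNReal.ofReal (φ x ^ 2) = ENNReal.ofReal (∫ x in Ω, φ x ^ 2) := by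
  simpa using lintegral_ofReal_eq_of_memLp_two (memLp_two_volume_restrict ho hb hφ.continuous)

theorem lintegral_gradient_sq_eq_ofReal {Ω : Set Plane} (ho : IsOpen Ω)
    (hb : Bornology.IsBounded Ω) {φ : Plane → ℝ} (hφ : ContDiff ℝ ∞ φ) :
    ∫⁻ x in Ω, ENNReal.ofReal (‖gradient φ x‖ ^ 2)
      = ENNReal.ofReal (∫ x in Ω, ‖gradient φ x‖ ^ 2) :=
  lintegral_ofReal_eq_of_memLp_two (memLp_two_volume_restrict ho hb (continuous_gradient hφ))

theorem lintegral_arcLength_sq_eq_ofReal {Ω : Set Plane} (hb : Bornology.IsBounded Ω)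
    [IsFiniteMeasure (arcLength Ω)] {φ : Plane → ℝ} (hφ : ContDiff ℝ ∞ φ) :
    ∫⁻ x, ENNReal.ofReal (φ x ^ 2) ∂(arcLength Ω)
      = ENNReal.ofReal (∫ x, φ x ^ 2 ∂(arcLength Ω)) := by
  simpa using lintegral_ofReal_eq_of_memLp_two (memLp_two_arcLength hb hφ.continuous)

theorem le_of_ofReal_le_add {x A B y z : ℝ} (hA : 0 ≤ A) (hB : 0 ≤ B) (hy : 0 ≤ y) (hz : 0 ≤ z)
    (h : ENNReal.ofReal x ≤ ENNReal.ofReal A * ENNReal.ofReal y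
      + ENNReal.ofReal B * ENNReal.ofReal z) : x ≤ A * y + B * z := by
  rw [← ENNReal.ofReal_mul hA, ← ENNReal.ofReal_mul hB,
    ← ENNReal.ofReal_add (by positivity) (by positivity)] at h
  exact (ENNReal.ofReal_le_ofReal_iff (by positivity)).1 h

/-- The trace estimate with `ε = 1 / (|β| + 1)` gives `|β| * ε ≤ 1`, so the Dirichlet energy absorbs
the gradient part of the boundary term. -/
theorem IsBoundedLipschitzDomain.bddBelow_robinValues {Ω : Set Plane}
    (hΩ : IsBoundedLipschitzDomain Ω) (β : ℝ) : BddBelow (robinValues Ω β) := by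
  have ho := hΩ.isOpen
  have hb := hΩ.isBounded
  have := hΩ.isFiniteMeasure_arcLength
  obtain ⟨C, hC, hest⟩ := hΩ.hasTraceEstimate.2 (1 / (|β| + 1)) (by positivity)
  refine ⟨-(|β| * C), fun q hq => le_of_mem_robinValues ho hb (fun φ hφ => ?_) q hq⟩
  have h := hest φ hφ
  rw [inter_self] at h
  have h' : ENNReal.ofReal (∫ x, φ x ^ 2 ∂(arcLength Ω)) ≤ _ :=
    (lintegral_arcLength_sq_eq_ofReal hb hφ).symm.trans_le h
  rw [lintegral_gradient_sq_eq_ofReal ho hb hφ, lintegral_sq_eq_ofReal ho hb hφ] at h'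
  have i1 : 0 ≤ ∫ x in Ω, ‖gradient φ x‖ ^ 2 := integral_nonneg fun x => by positivity
  have i2 : 0 ≤ ∫ x in Ω, φ x ^ 2 := integral_nonneg fun x => sq_nonneg _
  have i3 : 0 ≤ ∫ x, φ x ^ 2 ∂(arcLength Ω) := integral_nonneg fun x => sq_nonneg _
  have h2 := le_of_ofReal_le_add (by positivity) hC i1 i2 h'
  have h3 := mul_le_mul_of_nonneg_left h2 (abs_nonneg β)
  have h4 : |β| * (1 / (|β| + 1) * ∫ x in Ω, ‖gradient φ x‖ ^ 2) ≤
      ∫ x in Ω, ‖gradient φ x‖ ^ 2 := by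
    rw [← mul_assoc]
    refine mul_le_of_le_one_left i1 ?_
    rw [mul_one_div, div_le_one (by positivity)]
    linarith
  nlinarith [mul_le_mul_of_nonneg_right (neg_abs_le β) i3]
/-! ### Rectangles -/

/-- The linear isometry of the plane with a given orthogonal matrix. -/
noncomputable def planeIsometry (p q r s : ℝ) (h₁ : p ^ 2 + r ^ 2 = 1) (h₂ : q ^ 2 + s ^ 2 = 1)
    (h₃ : p * q + r * s = 0) : Plane ≃ₗᵢ[ℝ] Plane :=
  LinearIsometry.toLinearIsometryEquiv
    { toFun := fun y => !₂[p * y 0 + q * y 1, r * y 0 + s * y 1]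
      map_add' := fun x y => by ext i; fin_cases i <;> simp <;> ring
      map_smul' := fun c y => by ext i; fin_cases i <;> simp <;> ring
      norm_map' := fun y => by
        rw [EuclideanSpace.norm_eq, EuclideanSpace.norm_eq]
        congr 1
        simp only [LinearMap.coe_mk, AddHom.coe_mk, Fin.sum_univ_two, Matrix.cons_val_zero,
          Matrix.cons_val_one, Real.norm_eq_abs, sq_abs]
        linear_combination y 0 ^ 2 * h₁ + y 1 ^ 2 * h₂ + 2 * y 0 * y 1 * h₃ }
    rfl

theorem planeIsometry_apply (p q r s : ℝ) (h₁ : p ^ 2 + r ^ 2 = 1) (h₂ : q ^ 2 + s ^ 2 = 1)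
    (h₃ : p * q + r * s = 0) (y : Plane) :
    planeIsometry p q r s h₁ h₂ h₃ y = !₂[p * y 0 + q * y 1, r * y 0 + s * y 1] := rfl

theorem graphPoint_eq_iff (e : Plane ≃ₗᵢ[ℝ] Plane) (b : ℝ → ℝ) (s t : ℝ) (z : Plane) :
    graphPoint e b s t = z ↔ e z = !₂[s, b s + t] := by
  rw [graphPoint, LinearIsometryEquiv.symm_apply_eq, eq_comm]

/-- Presents a side of a rectangle as the graph of a constant; the sign `τ` turns the positive
height into the inward direction. -/
theorem exists_graphPoint_horizontal (c : ℝ) {τ : ℝ} (hτ : τ ^ 2 = 1) :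
    ∃ (e : Plane ≃ₗᵢ[ℝ] Plane) (b : ℝ → ℝ), Measurable b ∧
      ∀ s t, graphPoint e b s t = !₂[s, c + τ * t] := by
  refine ⟨planeIsometry 1 0 0 τ (by norm_num) (by linarith) (by ring), fun _ => τ * c,
    measurable_const, fun s t => ?_⟩
  rw [graphPoint_eq_iff, planeIsometry_apply]
  ext i
  fin_cases i
  · simp
  · simp only [Fin.mk_one, Matrix.cons_val_one, Matrix.cons_val_zero]
    linear_combination t * hτ

theorem exists_graphPoint_vertical (c : ℝ) {τ : ℝ} (hτ : τ ^ 2 = 1) :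
    ∃ (e : Plane ≃ₗᵢ[ℝ] Plane) (b : ℝ → ℝ), Measurable b ∧
      ∀ s t, graphPoint e b s t = !₂[c + τ * t, s] := by
  refine ⟨planeIsometry 0 1 τ 0 (by linarith) (by norm_num) (by ring), fun _ => τ * c,
    measurable_const, fun s t => ?_⟩
  rw [graphPoint_eq_iff, planeIsometry_apply]
  ext i
  fin_cases i
  · simp
  · simp only [Fin.mk_one, Matrix.cons_val_one, Matrix.cons_val_zero]
    linear_combination t * hτ

theorem isOpen_openRectangle (a b : ℝ) : IsOpen (openRectangle a b) :=
  ((isOpen_Ioo (a := 0) (b := a)).preimage (by fun_prop : Continuous fun y : Plane => y 0)).inter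
    ((isOpen_Ioo (a := 0) (b := b)).preimage (by fun_prop : Continuous fun y : Plane => y 1))

theorem isBounded_openRectangle (a b : ℝ) : Bornology.IsBounded (openRectangle a b) := by
  refine (Metric.isBounded_iff_subset_ball 0).2 ⟨|a| + |b| + 1, fun y hy => ?_⟩
  rw [mem_ball_zero_iff, EuclideanSpace.norm_eq, Real.sqrt_lt' (by positivity)]
  obtain ⟨⟨h1, h2⟩, h3, h4⟩ := hy
  simp only [Fin.sum_univ_two, Real.norm_eq_abs, sq_abs]
  nlinarith [le_abs_self a, le_abs_self b, abs_nonneg a, abs_nonneg b]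

theorem isConnected_openRectangle {a b : ℝ} (ha : 0 < a) (hb : 0 < b) :
    IsConnected (openRectangle a b) := by
  refine ⟨⟨!₂[a / 2, b / 2], ?_⟩, Convex.isPreconnected ?_⟩
  · refine ⟨⟨?_, ?_⟩, ?_, ?_⟩ <;> simp <;> linarith
  · have h : ∀ (i : Fin 2) (c : ℝ), Convex ℝ {y : Plane | 0 < y i ∧ y i < c} := fun i c =>
      (convex_Ioo 0 c).linear_preimage (EuclideanSpace.proj i : Plane →L[ℝ] ℝ).toLinearMap
    exact (h 0 a).inter (h 1 b)

theorem mem_frontier_openRectangle {a b : ℝ} (ha : 0 < a) (hb : 0 < b) (y : Plane) :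
    y ∈ frontier (openRectangle a b) ↔
      (y 0 ∈ Icc 0 a ∧ (y 1 = 0 ∨ y 1 = b)) ∨ ((y 0 = 0 ∨ y 0 = a) ∧ y 1 ∈ Icc 0 b) := by
  let h : Plane ≃ₜ ℝ × ℝ :=
    (EuclideanSpace.equiv (Fin 2) ℝ).toHomeomorph.trans Homeomorph.finTwoArrow
  have hR : openRectangle a b = h ⁻¹' (Ioo 0 a ×ˢ Ioo 0 b) := rfl
  rw [hR, ← h.preimage_frontier, frontier_prod_eq, frontier_Ioo ha, frontier_Ioo hb,
    closure_Ioo ha.ne, closure_Ioo hb.ne]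
  rfl

/-- A window of radius at most `a / 4` around `p` can see only one endpoint constraint. The sign `σ`
orients the remaining one, and `c` is its endpoint. -/
theorem exists_one_sided_interval {a p : ℝ} {ρ : ℝ} (hρ : ρ ≤ a / 4)
    (hρ0 : 0 < ρ) :
    ∃ σ c : ℝ, σ ^ 2 = 1 ∧ ∀ x, |x - p| < ρ → ((0 < x ∧ x < a) ↔ σ * c < σ * x) := by
  rcases le_total p (a / 2) with h | h
  · refine ⟨1, 0, by norm_num, fun x hx => ?_⟩
    rw [abs_lt] at hx
    constructor
    · rintro ⟨h1, -⟩; linarith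
    · exact fun h1 => ⟨by linarith, by linarith⟩
  · refine ⟨-1, a, by norm_num, fun x hx => ?_⟩
    rw [abs_lt] at hx
    constructor
    · rintro ⟨-, h1⟩; linarith
    · exact fun h1 => ⟨by linarith, by linarith⟩

theorem isBoundedLipschitzDomain_openRectangle {a b : ℝ} (ha : 0 < a) (hb : 0 < b) :
    IsBoundedLipschitzDomain (openRectangle a b) where
  isOpen := isOpen_openRectangle a b
  isConnected := isConnected_openRectangle ha hb
  isBounded := isBounded_openRectangle a b
  lipschitz_boundary := by
    intro p _
    have hρ : 0 < min a b / 4 := by have := lt_min ha hb; linarith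
    obtain ⟨σ, x₀, hσ, hx⟩ := exists_one_sided_interval (p := p 0)
      (div_le_div_of_nonneg_right (min_le_left a b) (by norm_num)) hρ
    obtain ⟨τ, y₀, hτ, hy⟩ := exists_one_sided_interval (p := p 1)
      (div_le_div_of_nonneg_right (min_le_right a b) (by norm_num)) hρ
    -- Locally the rectangle is a quadrant. Rotated by 45 degrees (after reflections), a quadrant
    -- lies above the maximum of two lines of slope `-1` and `1`. This chart serves edge points and
    -- corners alike.
    set c : ℝ := √2 / 2 with hc
    have hc0 : 0 < c := by positivity
    have hc2 : 2 * c ^ 2 = 1 := by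
      rw [hc, div_pow, Real.sq_sqrt (by norm_num)]; norm_num
    refine ⟨planeIsometry (c * σ) (-(c * τ)) (c * σ) (c * τ) ?_ ?_ ?_, 1,
      fun u => max (2 * c * (σ * x₀) - u) (2 * c * (τ * y₀) + u), min a b / 4, ?_, hρ, ?_⟩
    · linear_combination σ ^ 2 * hc2 + hσ
    · linear_combination τ ^ 2 * hc2 + hτ
    · ring
    · have h1 : LipschitzWith 1 fun u : ℝ => 2 * c * (σ * x₀) - u :=
        LipschitzWith.of_dist_le_mul fun u v => by
          rw [Real.dist_eq, Real.dist_eq, sub_sub_sub_cancel_left, NNReal.coe_one, one_mul,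
            abs_sub_comm]
      have h2 : LipschitzWith 1 fun u : ℝ => 2 * c * (τ * y₀) + u :=
        LipschitzWith.of_dist_le_mul fun u v => by simp
      simpa using h1.max h2
    · intro y hyr
      rw [Metric.mem_ball, dist_eq_norm] at hyr
      have i0 := hx (y 0) (lt_of_le_of_lt (by simpa using PiLp.norm_apply_le (y - p) 0) hyr)
      have i1 := hy (y 1) (lt_of_le_of_lt (by simpa using PiLp.norm_apply_le (y - p) 1) hyr)
      rw [planeIsometry_apply]
      simp only [Matrix.cons_val_zero, Matrix.cons_val_one, max_lt_iff]
      refine (and_congr i0 i1).trans (and_congr ?_ ?_)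
      · rw [← mul_lt_mul_iff_right₀ (show 0 < 2 * c by positivity)]
        constructor <;> intro h <;> linarith
      · rw [← mul_lt_mul_iff_right₀ (show 0 < 2 * c by positivity)]
        constructor <;> intro h <;> linarith

/-! ### Boundary measure, perimeter and area of a rectangle -/

theorem isometry_horizontal (c : ℝ) : Isometry fun s : ℝ => (!₂[s, c] : Plane) :=
  Isometry.of_dist_eq fun s s' => by simp [EuclideanSpace.dist_eq]

theorem isometry_vertical (c : ℝ) : Isometry fun s : ℝ => (!₂[c, s] : Plane) :=
  Isometry.of_dist_eq fun s s' => by simp [EuclideanSpace.dist_eq]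

theorem hausdorffMeasure_restrict_image {h : ℝ → Plane} (hh : Isometry h) (J : Set ℝ) :
    (Measure.hausdorffMeasure 1 : Measure Plane).restrict (h '' J) = (volume.restrict J).map h := by
  have hm := hh.continuous.measurable
  have hemb : MeasurableEmbedding h := hh.isClosedEmbedding.measurableEmbedding
  refine Measure.ext fun E hE => ?_
  rw [Measure.map_apply hm hE, Measure.restrict_apply hE, Measure.restrict_apply (hm hE),
    ← image_preimage_inter, hh.hausdorffMeasure_image (Or.inl zero_le_one), hausdorffMeasure_real]

theorem horizontal_image_eq (c a : ℝ) :
    (fun s : ℝ => (!₂[s, c] : Plane)) '' Ioo 0 a = {y | (0 < y 0 ∧ y 0 < a) ∧ y 1 = c} := by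
  ext y
  constructor
  · rintro ⟨s, hs, rfl⟩
    simpa using hs
  · rintro ⟨h, h'⟩
    exact ⟨y 0, h, by ext i; fin_cases i <;> simp [h']⟩

theorem vertical_image_eq (c b : ℝ) :
    (fun s : ℝ => (!₂[c, s] : Plane)) '' Ioo 0 b = {y | y 0 = c ∧ (0 < y 1 ∧ y 1 < b)} := by
  ext y
  constructor
  · rintro ⟨s, hs, rfl⟩
    simpa using hs
  · rintro ⟨h', h⟩
    exact ⟨y 1, h, by ext i; fin_cases i <;> simp [h']⟩

/-- The four open sides are disjoint and miss only the corners, a finite and hence null set; each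
side is an isometric image of an interval. -/
theorem arcLength_openRectangle {a b : ℝ} (ha : 0 < a) (hb : 0 < b) :
    arcLength (openRectangle a b) =
      (volume.restrict (Ioo 0 a)).map (fun s : ℝ => (!₂[s, 0] : Plane))
      + (volume.restrict (Ioo 0 a)).map (fun s : ℝ => (!₂[s, b] : Plane))
      + (volume.restrict (Ioo 0 b)).map (fun s : ℝ => (!₂[0, s] : Plane))
      + (volume.restrict (Ioo 0 b)).map (fun s : ℝ => (!₂[a, s] : Plane)) := by
  rw [← hausdorffMeasure_restrict_image (isometry_horizontal 0) (Ioo _ _),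
    ← hausdorffMeasure_restrict_image (isometry_horizontal b) (Ioo _ _),
    ← hausdorffMeasure_restrict_image (isometry_vertical 0) (Ioo _ _),
    ← hausdorffMeasure_restrict_image (isometry_vertical a) (Ioo _ _)]
  have hmeas : ∀ {h : ℝ → Plane}, Isometry h → ∀ c : ℝ, MeasurableSet (h '' Ioo 0 c) :=
    fun hh c => hh.isClosedEmbedding.measurableEmbedding.measurableSet_image.2 measurableSet_Ioo
  rw [← Measure.restrict_union _ (hmeas (isometry_horizontal b) a),
    ← Measure.restrict_union _ (hmeas (isometry_vertical 0) b),
    ← Measure.restrict_union _ (hmeas (isometry_vertical a) b), arcLength]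
  · refine Measure.restrict_congr_set (Filter.EventuallyLE.antisymm ?_ ?_)
    · have hnull : (Measure.hausdorffMeasure 1 : Measure Plane)
          {!₂[0, 0], !₂[a, 0], !₂[0, b], !₂[a, b]} = 0 := by
        have := Measure.nullSingletonClass_hausdorff Plane (d := 1) one_pos
        exact (Set.toFinite _).measure_zero _
      rw [ae_le_set]
      refine measure_mono_null (fun y hy => ?_) hnull
      obtain ⟨hy1, hy2⟩ := hy
      rw [horizontal_image_eq, horizontal_image_eq, vertical_image_eq, vertical_image_eq] at hy2
      simp only [mem_union, mem_ofPred_eq, not_or] at hy2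
      have hy3 : (y 0 = 0 ∨ y 0 = a) ∧ (y 1 = 0 ∨ y 1 = b) := by
        rw [mem_frontier_openRectangle ha hb] at hy1
        simp only [mem_Icc] at hy1
        have aux : ∀ u v : ℝ, (0 ≤ u ∧ u ≤ a) ∧ (v = 0 ∨ v = b) ∨
            (u = 0 ∨ u = a) ∧ (0 ≤ v ∧ v ≤ b) →
            ((¬((0 < u ∧ u < a) ∧ v = 0) ∧ ¬((0 < u ∧ u < a) ∧ v = b)) ∧
              ¬(u = 0 ∧ (0 < v ∧ v < b))) ∧ ¬(u = a ∧ (0 < v ∧ v < b)) →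
            (u = 0 ∨ u = a) ∧ (v = 0 ∨ v = b) := by grind
        exact aux _ _ hy1 hy2
      have hext : ∀ u v : ℝ, y 0 = u → y 1 = v → y = !₂[u, v] := fun u v hu hv => by
        ext i; fin_cases i <;> simp [hu, hv]
      simp only [mem_insert_iff, mem_singleton_iff]
      rcases hy3 with ⟨h | h, h' | h'⟩ <;> simp [hext _ _ h h']
    · refine LE.le.eventuallyLE ?_
      rw [horizontal_image_eq, horizontal_image_eq, vertical_image_eq, vertical_image_eq]
      intro y hy
      rw [mem_frontier_openRectangle ha hb]
      simp only [mem_union, mem_ofPred_eq] at hy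
      simp only [mem_Icc]
      grind
  all_goals
    simp only [horizontal_image_eq, vertical_image_eq]
    refine Set.disjoint_left.2 fun y hy hy' => ?_
    simp only [mem_union, mem_ofPred_eq] at hy hy'
    grind

theorem lintegral_arcLength_openRectangle {a b : ℝ} (ha : 0 < a) (hb : 0 < b) {g : Plane → ℝ≥0∞}
    (hg : Measurable g) :
    ∫⁻ x, g x ∂(arcLength (openRectangle a b)) =
      (∫⁻ s in Ioo 0 a, g !₂[s, 0]) + (∫⁻ s in Ioo 0 a, g !₂[s, b])
        + (∫⁻ s in Ioo 0 b, g !₂[0, s]) + ∫⁻ s in Ioo 0 b, g !₂[a, s] := by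
  rw [arcLength_openRectangle ha hb, lintegral_add_measure, lintegral_add_measure,
    lintegral_add_measure, lintegral_map hg (isometry_horizontal 0).continuous.measurable,
    lintegral_map hg (isometry_horizontal b).continuous.measurable,
    lintegral_map hg (isometry_vertical 0).continuous.measurable,
    lintegral_map hg (isometry_vertical a).continuous.measurable]

theorem perimeter_openRectangle {a b : ℝ} (ha : 0 < a) (hb : 0 < b) :
    perimeter (openRectangle a b) = 2 * (a + b) := by
  have h := lintegral_arcLength_openRectangle ha hb (g := 1) measurable_one
  simp only [Pi.one_apply, lintegral_one, Measure.restrict_apply_univ, Real.volume_Ioo,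
    sub_zero] at h
  rw [perimeter, h, ← ENNReal.ofReal_add ha.le ha.le, ← ENNReal.ofReal_add (by positivity) hb.le,
    ← ENNReal.ofReal_add (by positivity) hb.le, ENNReal.toReal_ofReal (by positivity)]
  ring

theorem area_openRectangle {a b : ℝ} (ha : 0 < a) (hb : 0 < b) :
    area (openRectangle a b) = a * b := by
  obtain ⟨e, β, hβ, he⟩ := exists_graphPoint_horizontal 0 (one_pow 2 : (1 : ℝ) ^ 2 = 1)
  have h := lintegral_graphPoint_eq e hβ (J := Ioo 0 a) (ℓ := b)
    (isOpen_openRectangle a b).measurableSet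
    (fun s t => by rw [he]; simp [openRectangle]) (g := 1) measurable_one
  simp only [Pi.one_apply, lintegral_one, Measure.restrict_apply_univ, Real.volume_Ioo,
    sub_zero, lintegral_const] at h
  rw [area, ← h, ENNReal.toReal_mul, ENNReal.toReal_ofReal hb.le, ENNReal.toReal_ofReal ha.le,
    mul_comm]

/-! ### Trace inequalities on rectangles -/

section

variable {a b : ℝ} {φ : Plane → ℝ}

theorem lintegral_horizontal_le {c τ ℓ η : ℝ} (hτ : τ ^ 2 = 1) (hℓ : 0 < ℓ) (hη : 0 < η)
    (hc : ∀ t ∈ Ioo 0 ℓ, 0 < c + τ * t ∧ c + τ * t < b) (hφ : ContDiff ℝ ∞ φ) :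
    ∫⁻ s in Ioo 0 a, ENNReal.ofReal (φ !₂[s, c] ^ 2) ≤
      ENNReal.ofReal ((1 + η) / ℓ) * (∫⁻ x in openRectangle a b, ENNReal.ofReal (φ x ^ 2))
      + ENNReal.ofReal ((1 + 1 / η) * ℓ)
        * ∫⁻ x in openRectangle a b, ENNReal.ofReal (‖gradient φ x‖ ^ 2) := by
  obtain ⟨e, β, hβ, he⟩ := exists_graphPoint_horizontal c hτ
  have h := lintegral_trace_graph_le e hβ (J := Ioo 0 a) hℓ hη
    (isOpen_openRectangle a b).measurableSet (fun s hs t ht => by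
      rw [he]; exact ⟨by simpa using hs, by simpa using hc t ht⟩) hφ
  simpa only [he, mul_zero, add_zero] using h

theorem lintegral_vertical_le {c τ ℓ η : ℝ} (hτ : τ ^ 2 = 1) (hℓ : 0 < ℓ) (hη : 0 < η)
    (hc : ∀ t ∈ Ioo 0 ℓ, 0 < c + τ * t ∧ c + τ * t < a) (hφ : ContDiff ℝ ∞ φ) :
    ∫⁻ s in Ioo 0 b, ENNReal.ofReal (φ !₂[c, s] ^ 2) ≤
      ENNReal.ofReal ((1 + η) / ℓ) * (∫⁻ x in openRectangle a b, ENNReal.ofReal (φ x ^ 2))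
      + ENNReal.ofReal ((1 + 1 / η) * ℓ)
        * ∫⁻ x in openRectangle a b, ENNReal.ofReal (‖gradient φ x‖ ^ 2) := by
  obtain ⟨e, β, hβ, he⟩ := exists_graphPoint_vertical c hτ
  have h := lintegral_trace_graph_le e hβ (J := Ioo 0 b) hℓ hη
    (isOpen_openRectangle a b).measurableSet (fun s hs t ht => by
      rw [he]; exact ⟨by simpa using hc t ht, by simpa using hs⟩) hφ
  simpa only [he, mul_zero, add_zero] using h

theorem lintegral_le_horizontal {c τ η : ℝ} (hτ : τ ^ 2 = 1) (hb : 0 < b) (hη : 0 < η)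
    (hc : ∀ t, (0 < c + τ * t ∧ c + τ * t < b) ↔ (0 < t ∧ t < b)) (hφ : ContDiff ℝ ∞ φ) :
    ∫⁻ x in openRectangle a b, ENNReal.ofReal (φ x ^ 2) ≤
      ENNReal.ofReal ((1 + η) * b) * (∫⁻ s in Ioo 0 a, ENNReal.ofReal (φ !₂[s, c] ^ 2))
      + ENNReal.ofReal ((1 + 1 / η) * b ^ 2)
        * ∫⁻ x in openRectangle a b, ENNReal.ofReal (‖gradient φ x‖ ^ 2) := by
  obtain ⟨e, β, hβ, he⟩ := exists_graphPoint_horizontal c hτ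
  have h := lintegral_sq_le_trace_graph e hβ (J := Ioo 0 a) hb hη
    (isOpen_openRectangle a b).measurableSet (fun s t => by
      rw [he]; simp [openRectangle, hc]) hφ
  simpa only [he, mul_zero, add_zero] using h

/-- The two sides of length `a` use the full depth `b`, giving the leading coefficient `2 * (1 + η)
/ b`. The other two use depth `δ * a` and Young parameter `1`; their share `4 / (δ * a)` is of lower
order when `b` is small against `δ * a`. -/
theorem integral_arcLength_sq_le (ha : 0 < a) (hb : 0 < b) {η δ : ℝ} (hη : 0 < η) (hδ : 0 < δ)
    (hδ1 : δ ≤ 1) (hφ : ContDiff ℝ ∞ φ) :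
    ∫ x, φ x ^ 2 ∂(arcLength (openRectangle a b)) ≤
      (2 * (1 + η) / b + 4 / (δ * a)) * (∫ x in openRectangle a b, φ x ^ 2)
      + (2 * (1 + 1 / η) * b + 4 * (δ * a)) * ∫ x in openRectangle a b, ‖gradient φ x‖ ^ 2 := by
  have hR := isBoundedLipschitzDomain_openRectangle ha hb
  have := hR.isFiniteMeasure_arcLength
  have hg : Measurable fun x => ENNReal.ofReal (φ x ^ 2) :=
    ((hφ.continuous.pow 2).measurable).ennreal_ofReal
  have hδa : 0 < δ * a := mul_pos hδ ha
  have hδa' : δ * a ≤ a := by nlinarith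
  refine le_of_ofReal_le_add (by positivity) (by positivity)
    (integral_nonneg fun x => sq_nonneg _) (integral_nonneg fun x => by positivity) ?_
  rw [← lintegral_arcLength_sq_eq_ofReal hR.isBounded hφ,
    ← lintegral_sq_eq_ofReal hR.isOpen hR.isBounded hφ,
    ← lintegral_gradient_sq_eq_ofReal hR.isOpen hR.isBounded hφ,
    lintegral_arcLength_openRectangle ha hb hg]
  have e1 := lintegral_horizontal_le (a := a) (b := b) (c := 0) (τ := 1) (by norm_num) hb hη
    (fun t ht => by simpa using ht) hφ
  have e2 := lintegral_horizontal_le (a := a) (b := b) (c := b) (τ := -1) (by norm_num) hb hη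
    (fun t ht => ⟨by linarith [ht.2], by linarith [ht.1]⟩) hφ
  have e3 := lintegral_vertical_le (a := a) (b := b) (c := 0) (τ := 1) (by norm_num) hδa one_pos
    (fun t ht => ⟨by linarith [ht.1], by linarith [ht.2]⟩) hφ
  have e4 := lintegral_vertical_le (a := a) (b := b) (c := a) (τ := -1) (by norm_num) hδa one_pos
    (fun t ht => ⟨by linarith [ht.2], by linarith [ht.1]⟩) hφ
  refine (add_le_add (add_le_add (add_le_add e1 e2) e3) e4).trans (le_of_eq ?_)
  rw [show 2 * (1 + η) / b + 4 / (δ * a) =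
      (1 + η) / b + (1 + η) / b + (1 + 1) / (δ * a) + (1 + 1) / (δ * a) by ring,
    show 2 * (1 + 1 / η) * b + 4 * (δ * a) = (1 + 1 / η) * b + (1 + 1 / η) * b
      + (1 + 1 / 1) * (δ * a) + (1 + 1 / 1) * (δ * a) by ring]
  rw [ENNReal.ofReal_add (by positivity) (by positivity),
    ENNReal.ofReal_add (by positivity) (by positivity),
    ENNReal.ofReal_add (by positivity) (by positivity),
    ENNReal.ofReal_add (p := _ + _ + _) (by positivity) (by positivity),
    ENNReal.ofReal_add (p := _ + _) (by positivity) (by positivity),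
    ENNReal.ofReal_add (p := (1 + 1 / η) * b) (by positivity) (by positivity)]
  ring

/-- Each side of length `a` alone controls the area integral; add the two bounds. The remaining
sides only enlarge the boundary integral. -/
theorem two_mul_integral_sq_le (ha : 0 < a) (hb : 0 < b) {η : ℝ} (hη : 0 < η)
    (hφ : ContDiff ℝ ∞ φ) :
    2 * ∫ x in openRectangle a b, φ x ^ 2 ≤
      (1 + η) * b * (∫ x, φ x ^ 2 ∂(arcLength (openRectangle a b)))
      + 2 * (1 + 1 / η) * b ^ 2 * ∫ x in openRectangle a b, ‖gradient φ x‖ ^ 2 := by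
  have hR := isBoundedLipschitzDomain_openRectangle ha hb
  have := hR.isFiniteMeasure_arcLength
  have hg : Measurable fun x => ENNReal.ofReal (φ x ^ 2) :=
    ((hφ.continuous.pow 2).measurable).ennreal_ofReal
  refine le_of_ofReal_le_add (by positivity) (by positivity)
    (integral_nonneg fun x => sq_nonneg _) (integral_nonneg fun x => by positivity) ?_
  rw [ENNReal.ofReal_mul zero_le_two, ← lintegral_arcLength_sq_eq_ofReal hR.isBounded hφ,
    ← lintegral_sq_eq_ofReal hR.isOpen hR.isBounded hφ,
    ← lintegral_gradient_sq_eq_ofReal hR.isOpen hR.isBounded hφ,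
    lintegral_arcLength_openRectangle ha hb hg]
  have e1 := lintegral_le_horizontal (a := a) (b := b) (c := 0) (τ := 1) (by norm_num) hb hη
    (fun t => by simp) hφ
  have e2 := lintegral_le_horizontal (a := a) (b := b) (c := b) (τ := -1) (by norm_num) hb hη
    (fun t => ⟨fun h => ⟨by linarith [h.2], by linarith [h.1]⟩,
      fun h => ⟨by linarith [h.2], by linarith [h.1]⟩⟩) hφ
  have e := add_le_add e1 e2
  rw [← two_mul] at e
  rw [ENNReal.ofReal_ofNat]
  refine e.trans ?_
  rw [show 2 * (1 + 1 / η) * b ^ 2 = 2 * ((1 + 1 / η) * b ^ 2) by ring,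
    ENNReal.ofReal_mul zero_le_two, ENNReal.ofReal_ofNat, add_add_add_comm, ← mul_add, ← two_mul,
    mul_assoc]
  refine add_le_add (mul_le_mul_right ?_ _) le_rfl
  rw [add_assoc]
  exact le_self_add

end

/-! ### Lower bounds for thin rectangles and the limit -/

theorem le_robinEigenvalue₁ {Ω : Set Plane} (hΩ : IsBoundedLipschitzDomain Ω) {c β : ℝ}
    (h : ∀ φ : Plane → ℝ, ContDiff ℝ ∞ φ → c * ∫ x in Ω, φ x ^ 2 ≤
      (∫ x in Ω, ‖gradient φ x‖ ^ 2) + β * ∫ x, φ x ^ 2 ∂(arcLength Ω)) :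
    c ≤ robinEigenvalue₁ Ω β := by
  have := hΩ.isFiniteMeasure_arcLength
  -- The constant `1` shows that the infimum is over a nonempty set.
  refine le_csInf ⟨_, robinQuotient_mem_robinValues hΩ.isOpen hΩ.isBounded
    (u := fun _ => 1) contDiff_const (fun h0 => ?_) β⟩
    (le_of_mem_robinValues hΩ.isOpen hΩ.isBounded h)
  have : ∀ᵐ x ∂(volume.restrict Ω), False := h0.mono fun x hx => one_ne_zero hx
  rw [ae_iff] at this
  simp [(hΩ.isOpen.measure_pos volume hΩ.isConnected.nonempty).ne'] at this

/-- Here `r ^ 2` is the side ratio and `η = r`. The constant is chosen so that `c / 2` times the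
boundary coefficient is exactly `α / L`; the gradient coefficient becomes `α * r / (1 + r ^ 2) ≤ 1`.
-/
theorem robinEigenvalue₁_openRectangle_ge_of_pos {α a r : ℝ} (hα : 0 < α) (ha : 0 < a)
    (hr : 0 < r) (hαr : α * r ≤ 1) :
    α / ((1 + r ^ 2) * (1 + r)) ≤
      robinEigenvalue₁ (openRectangle a (r ^ 2 * a))
        (α / perimeter (openRectangle a (r ^ 2 * a))) * area (openRectangle a (r ^ 2 * a)) := by
  have hb : 0 < r ^ 2 * a := by positivity
  rw [area_openRectangle ha hb, ← div_le_iff₀ (by positivity), perimeter_openRectangle ha hb]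
  refine le_robinEigenvalue₁ (isBoundedLipschitzDomain_openRectangle ha hb) fun φ hφ => ?_
  have h := two_mul_integral_sq_le ha hb hr hφ
  set U := ∫ x in openRectangle a (r ^ 2 * a), φ x ^ 2
  set T := ∫ x, φ x ^ 2 ∂(arcLength (openRectangle a (r ^ 2 * a)))
  set D := ∫ x in openRectangle a (r ^ 2 * a), ‖gradient φ x‖ ^ 2
  have hD : 0 ≤ D := integral_nonneg fun x => by positivity
  set c := α / ((1 + r ^ 2) * (1 + r)) / (a * (r ^ 2 * a)) with hc
  have hc0 : 0 ≤ c := by positivity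
  have h1 : c / 2 * ((1 + r) * (r ^ 2 * a)) = α / (2 * (a + r ^ 2 * a)) := by
    rw [hc]; field_simp
  have h2 : c / 2 * (2 * (1 + 1 / r) * (r ^ 2 * a) ^ 2) = α * r / (1 + r ^ 2) := by
    rw [hc]; field_simp; ring
  have h3 : α * r / (1 + r ^ 2) ≤ 1 := by
    rw [div_le_one (by positivity)]; nlinarith
  calc c * U = c / 2 * (2 * U) := by ring
    _ ≤ c / 2 * _ := mul_le_mul_of_nonneg_left h (by positivity)
    _ = α / (2 * (a + r ^ 2 * a)) * T + α * r / (1 + r ^ 2) * D := by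
      rw [← h1, ← h2]; ring
    _ ≤ _ := by nlinarith

/-- A negative boundary coefficient calls for an upper bound on the boundary integral, used with `η
= δ = r`. The extra `3 * r` collects `r` from Young's inequality and `2 * r` from the short sides.
-/
theorem robinEigenvalue₁_openRectangle_ge_of_neg {α a r : ℝ} (hα : α < 0) (ha : 0 < a)
    (hr : 0 < r) (hr1 : r ≤ 1) (hαr : -α * (4 * r) ≤ 1) :
    α * (1 + 3 * r) / (1 + r ^ 2) ≤
      robinEigenvalue₁ (openRectangle a (r ^ 2 * a))
        (α / perimeter (openRectangle a (r ^ 2 * a))) * area (openRectangle a (r ^ 2 * a)) := by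
  have hb : 0 < r ^ 2 * a := by positivity
  rw [area_openRectangle ha hb, ← div_le_iff₀ (by positivity), perimeter_openRectangle ha hb]
  refine le_robinEigenvalue₁ (isBoundedLipschitzDomain_openRectangle ha hb) fun φ hφ => ?_
  have h := integral_arcLength_sq_le ha hb hr hr hr1 hφ
  set U := ∫ x in openRectangle a (r ^ 2 * a), φ x ^ 2
  set T := ∫ x, φ x ^ 2 ∂(arcLength (openRectangle a (r ^ 2 * a)))
  set D := ∫ x in openRectangle a (r ^ 2 * a), ‖gradient φ x‖ ^ 2
  have hD : 0 ≤ D := integral_nonneg fun x => by positivity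
  have hβ : α / (2 * (a + r ^ 2 * a)) ≤ 0 :=
    div_nonpos_of_nonpos_of_nonneg hα.le (by positivity)
  have h1 : α / (2 * (a + r ^ 2 * a)) * (2 * (1 + r) / (r ^ 2 * a) + 4 / (r * a))
      = α * (1 + 3 * r) / (1 + r ^ 2) / (a * (r ^ 2 * a)) := by
    field_simp; ring
  have h2 : α / (2 * (a + r ^ 2 * a)) * (2 * (1 + 1 / r) * (r ^ 2 * a) + 4 * (r * a))
      = -(-α * (r ^ 2 + 3 * r) / (1 + r ^ 2)) := by
    field_simp; ring
  have h3 : -α * (r ^ 2 + 3 * r) / (1 + r ^ 2) ≤ 1 := by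
    rw [div_le_one (by positivity)]
    nlinarith [mul_nonneg (neg_nonneg.2 hα.le) (mul_nonneg hr.le (sub_nonneg.2 hr1))]
  have h4 := mul_le_mul_of_nonpos_left h hβ
  rw [mul_add, ← mul_assoc, ← mul_assoc, h1, h2] at h4
  nlinarith

theorem IsBoundedLipschitzDomain.perimeter_pos {Ω : Set Plane} (hΩ : IsBoundedLipschitzDomain Ω) :
    0 < perimeter Ω :=
  have := hΩ.isFiniteMeasure_arcLength
  _root_.perimeter_pos hΩ.isOpen hΩ.isConnected.nonempty hΩ.isBounded

theorem IsBoundedLipschitzDomain.robinEigenvalue₁_mul_area_lt {Ω : Set Plane}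
    (hΩ : IsBoundedLipschitzDomain Ω) {α : ℝ} (hα : α ≠ 0) :
    robinEigenvalue₁ Ω (α / perimeter Ω) * area Ω < α :=
  have := hΩ.isFiniteMeasure_arcLength
  _root_.robinEigenvalue₁_mul_area_lt hΩ.isOpen hΩ.isConnected.nonempty hΩ.isBounded
    hΩ.perimeter_pos hα (hΩ.bddBelow_robinValues _)

theorem tendsto_robinEigenvalue₁_openRectangle {α : ℝ} (hα : α ≠ 0) {ι : Type*} {l : Filter ι}
    {a b : ι → ℝ} (hpos : ∀ᶠ i in l, 0 < a i ∧ 0 < b i)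
    (hlim : Tendsto (fun i => b i / a i) l (𝓝 0)) :
    Tendsto (fun i => robinEigenvalue₁ (openRectangle (a i) (b i))
      (α / perimeter (openRectangle (a i) (b i))) * area (openRectangle (a i) (b i))) l (𝓝 α) := by
  -- The square root of the side ratio is the parameter `r` of both lower bounds, which then squeeze
  -- against the strict upper bound.
  have hr : Tendsto (fun i => √(b i / a i)) l (𝓝 0) := by
    simpa [Function.comp_def] using (Real.continuous_sqrt.tendsto 0).comp hlim
  have hform : ∀ᶠ i in l, 0 < a i ∧ 0 < √(b i / a i) ∧ b i = √(b i / a i) ^ 2 * a i := by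
    filter_upwards [hpos] with i ⟨h1, h2⟩
    refine ⟨h1, by positivity, ?_⟩
    rw [Real.sq_sqrt (by positivity), div_mul_cancel₀ _ h1.ne']
  have hupper : ∀ᶠ i in l, robinEigenvalue₁ (openRectangle (a i) (b i))
      (α / perimeter (openRectangle (a i) (b i))) * area (openRectangle (a i) (b i)) ≤ α :=
    hpos.mono fun i h =>
      ((isBoundedLipschitzDomain_openRectangle h.1 h.2).robinEigenvalue₁_mul_area_lt hα).le
  rcases hα.lt_or_gt with hneg | hp
  · have hlow : Tendsto (fun i => α * (1 + 3 * √(b i / a i)) / (1 + √(b i / a i) ^ 2)) l (𝓝 α) := by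
      have h : ContinuousAt (fun r : ℝ => α * (1 + 3 * r) / (1 + r ^ 2)) 0 :=
        ContinuousAt.div (by fun_prop) (by fun_prop) (by norm_num)
      simpa [Function.comp_def] using h.tendsto.comp hr
    have hev : ∀ᶠ i in l, √(b i / a i) ≤ 1 ∧ -α * (4 * √(b i / a i)) ≤ 1 := by
      have h : Tendsto (fun i => -α * (4 * √(b i / a i))) l (𝓝 (-α * (4 * 0))) :=
        (hr.const_mul 4).const_mul (-α)
      exact (hr.eventually_le_const one_pos).and (h.eventually_le_const (by norm_num))
    refine tendsto_of_tendsto_of_tendsto_of_le_of_le' hlow tendsto_const_nhds ?_ hupper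
    filter_upwards [hform, hev] with i ⟨h1, h2, h3⟩ ⟨h4, h5⟩
    have := robinEigenvalue₁_openRectangle_ge_of_neg hneg h1 h2 h4 h5
    rwa [← h3] at this
  · have hlow : Tendsto (fun i => α / ((1 + √(b i / a i) ^ 2) * (1 + √(b i / a i)))) l (𝓝 α) := by
      have h : ContinuousAt (fun r : ℝ => α / ((1 + r ^ 2) * (1 + r))) 0 :=
        ContinuousAt.div (by fun_prop) (by fun_prop) (by norm_num)
      simpa [Function.comp_def] using h.tendsto.comp hr
    have hev : ∀ᶠ i in l, α * √(b i / a i) ≤ 1 := by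
      have h : Tendsto (fun i => α * √(b i / a i)) l (𝓝 (α * 0)) := hr.const_mul α
      exact h.eventually_le_const (by norm_num)
    refine tendsto_of_tendsto_of_tendsto_of_le_of_le' hlow tendsto_const_nhds ?_ hupper
    filter_upwards [hform, hev] with i ⟨h1, h2, h3⟩ h4
    have := robinEigenvalue₁_openRectangle_ge_of_pos hp h1 h2 h4
    rwa [← h3] at this

/-- The sharp upper bound on the first Robin eigenvalue under perimeter scaling and area
normalization. The first two conjuncts of the bound say that the perimeter and the eigenvalue
in it are not default values: the boundary length is finite and positive, and the infimum
of the Rayleigh quotient is finite. The second part treats rectangles whose ratio of side lengths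
tends to zero, then in particular those of side lengths `t` and `1 / t` as `t → ∞`. -/
theorem theoremA (α : ℝ) (hα : α ≠ 0) :
    (∀ Ω : Set Plane, IsBoundedLipschitzDomain Ω →
      0 < perimeter Ω ∧
      BddBelow (robinValues Ω (α / perimeter Ω)) ∧
      robinEigenvalue₁ Ω (α / perimeter Ω) * area Ω < α) ∧
    (∀ (ι : Type) (l : Filter ι) (a b : ι → ℝ),
      (∀ᶠ i in l, 0 < a i ∧ 0 < b i) →
      Tendsto (fun i => b i / a i) l (𝓝 0) →
      Tendsto (fun i => robinEigenvalue₁ (openRectangle (a i) (b i))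
          (α / perimeter (openRectangle (a i) (b i))) * area (openRectangle (a i) (b i)))
        l (𝓝 α)) ∧
    (∀ t : ℝ, 0 < t →
      IsBoundedLipschitzDomain (openRectangle t (1 / t)) ∧ area (openRectangle t (1 / t)) = 1) ∧
    Tendsto (fun t : ℝ => robinEigenvalue₁ (openRectangle t (1 / t))
        (α / perimeter (openRectangle t (1 / t))) * area (openRectangle t (1 / t)))
      atTop (𝓝 α) := by
  have hrect : ∀ t : ℝ, 0 < t → IsBoundedLipschitzDomain (openRectangle t (1 / t)) :=
    fun t ht => isBoundedLipschitzDomain_openRectangle ht (by positivity)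
  refine ⟨fun Ω hΩ => ⟨hΩ.perimeter_pos, hΩ.bddBelow_robinValues _,
    hΩ.robinEigenvalue₁_mul_area_lt hα⟩,
    fun ι l a b => tendsto_robinEigenvalue₁_openRectangle hα,
    fun t ht => ⟨hrect t ht, ?_⟩, tendsto_robinEigenvalue₁_openRectangle hα ?_ ?_⟩
  · rw [area_openRectangle ht (by positivity)]
    field_simp
  · filter_upwards [eventually_gt_atTop 0] with t ht
    exact ⟨ht, by positivity⟩
  · have h := (tendsto_inv_atTop_zero (𝕜 := ℝ)).mul (tendsto_inv_atTop_zero (𝕜 := ℝ))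
    simpa [div_eq_mul_inv] using h
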